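/- Let $d\ge 1$, $0<\alpha\le 2$ and $0<\gamma<\min\{1,\alpha\}$. Let $p_t^{(\alpha)}(x,y)=p_t^{(\alpha)}(x-y)$ be the transition density of the rotationally invariant $\alpha$-stable process on $\mathbb R^d$, i.e. $\int_{\mathbb R^d}e^{-iy\cdot\xi}p_t^{(\alpha)}(y)\,dy=e^{-t|\xi|^\alpha}$, and let $\mathbb E^t_{x,y}$ denote expectation with respect to the corresponding stable bridge $(X_s)_{0\le s\le t}$ from $x$ at time $0$ to $y$ at time $t$: the measurable process with $X_0=x$, $X_t=y$ almost surely such that, for $0=s_0<s_1<\dots<s_n<s_{n+1}=t$, the vector $(X_{s_1},\dots,X_{s_n})$ has density $p_t^{(\alpha)}(x,y)^{-1}\prod_{j=0}^{n}p^{(\alpha)}_{s_{j+1}-s_j}(z_j,z_{j+1})$ with $z_0=x$, $z_{n+1}=y$. For $V:\mathbb R^d\to\mathbb R$ and $t>0$ put $$p_t^{H_V}(x,y)=p_t^{(\alpha)}(x,y)\,\mathbb E^t_{x,y}\Big[e^{-\int_0^tV(X_s)\,ds}\Big],\qquad Q_V^{(\alpha)}(t)=\int_{\mathbb R^d}\int_{\mathbb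 R^d}\big\{p_t^{H_V}(x,y)-p_t^{(\alpha)}(x,y)\big\}\,dx\,dy .$$ There is a constant $C>0$ depending only on $d$, $\gamma$ and $\alpha$ such that the following holds. Let $V\in L^\infty(\mathbb R^d)\cap L^1(\mathbb R^d)$ satisfy $|V(x)-V(y)|\le M|x-y|^\gamma$ for all $x,y\in\mathbb R^d$, where $M>0$. Then for all $t>0$ the double integral defining $Q_V^{(\alpha)}(t)$ converges absolutely and $$\Big|Q_V^{(\alpha)}(t)+t\int_{\mathbb R^d}V(x)\,dx-\frac{t^2}{2}\int_{\mathbb R^d}V^2(x)\,dx\Big|\le C\,\|V\|_1\Big(\|V\|_\infty^2e^{t\|V\|_\infty}t^3+M\,t^{\frac{\gamma}{\alpha}+2}\Big).$$ In particular, $$Q_V^{(\alpha)}(t)=-t\int_{\mathbb R^d}V(x)\,dx+\frac{t^2}{2}\int_{\mathbb R^d}V^2(x)\,dx+\mathcal O\big(t^{\frac{\gamma}{\alpha}+2}\big)\qquad\text{as }t\downarrow 0 .$$ -/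

import Mathlib

open MeasureTheory Filter Asymptotics
open scoped Topology ENNReal

/-- The transition density `p_t^{(α)}(z)` of the rotationally invariant `α`-stable process on `ℝ^d`
normalised by `∫ e^{-i y·ξ} p_t(y) dy = e^{-t|ξ|^α}`, written through Fourier inversion,
`p_t(z) = (2π)^{-d} ∫ e^{i z·ξ} e^{-t|ξ|^α} dξ`; the sine part integrates to zero by symmetry. -/
noncomputable def stableDensity {d : ℕ} (α t : ℝ) (z : EuclideanSpace ℝ (Fin d)) : ℝ :=
  ((2 * Real.pi) ^ d)⁻¹ *
    ∫ ξ : EuclideanSpace ℝ (Fin d), Real.cos (inner ℝ z ξ) * Real.exp (-t * ‖ξ‖ ^ α)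

/-- The density at `z = (z_1, …, z_n)` of `(X_{s_1}, …, X_{s_n})`, where `0 < s_1 < … < s_n < t`,
for the `α`-stable bridge from `x` at time `0` to `y` at time `t`:
`p_t(x,y)⁻¹ ∏_{j=0}^{n} p_{s_{j+1} - s_j}(z_j, z_{j+1})`, with `s_0 = 0`, `s_{n+1} = t`,
`z_0 = x`, `z_{n+1} = y`. -/
noncomputable def stableBridgeDensity {d : ℕ} (α t : ℝ) (x y : EuclideanSpace ℝ (Fin d))
    {n : ℕ} (s : Fin n → ℝ) (z : Fin n → EuclideanSpace ℝ (Fin d)) : ℝ :=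
  let τ : Fin (n + 2) → ℝ := Fin.cons 0 (Fin.snoc s t : Fin (n + 1) → ℝ)
  let ζ : Fin (n + 2) → EuclideanSpace ℝ (Fin d) :=
    Fin.cons x (Fin.snoc z y : Fin (n + 1) → EuclideanSpace ℝ (Fin d))
  (∏ j : Fin (n + 1), stableDensity α (τ j.succ - τ j.castSucc) (ζ j.castSucc - ζ j.succ)) /
    stableDensity α t (x - y)

/-- Under the probability measure `P`, the restriction of `X` to the time interval `[0, t]` is an
`α`-stable bridge from `x` to `y` of length `t`: a measurable process (for example one with
càdlàg paths) with the finite-dimensional distributions of the stable bridge. -/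
structure IsStableBridge {d : ℕ} {Ω : Type*} [MeasurableSpace Ω] (α t : ℝ)
    (x y : EuclideanSpace ℝ (Fin d)) (X : ℝ → Ω → EuclideanSpace ℝ (Fin d))
    (P : Measure Ω) : Prop where
  isProbabilityMeasure : IsProbabilityMeasure P
  measurable : Measurable (Function.uncurry X)
  start : ∀ᵐ ω ∂P, X 0 ω = x
  finish : ∀ᵐ ω ∂P, X t ω = y
  law : ∀ (n : ℕ) (s : Fin n → ℝ), StrictMono s → (∀ i, 0 < s i ∧ s i < t) →
    P.map (fun ω i => X (s i) ω) =
      (volume : Measure (Fin n → EuclideanSpace ℝ (Fin d))).withDensity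
        (fun z => ENNReal.ofReal (stableBridgeDensity α t x y s z))

/-- The heat kernel `p_t^{H_V}(x,y) = p_t(x,y) E^t_{x,y}[exp(-∫_0^t V(X_s) ds)]` of
`H_V = (-Δ)^{α/2} + V` (Feynman–Kac formula), where `P t x y` is the law of the bridge. -/
noncomputable def schrodingerKernel {d : ℕ} {Ω : Type*} [MeasurableSpace Ω] (α : ℝ)
    (X : ℝ → Ω → EuclideanSpace ℝ (Fin d))
    (P : ℝ → EuclideanSpace ℝ (Fin d) → EuclideanSpace ℝ (Fin d) → Measure Ω)
    (V : EuclideanSpace ℝ (Fin d) → ℝ) (t : ℝ) (x y : EuclideanSpace ℝ (Fin d)) : ℝ :=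
  stableDensity α t (x - y) * ∫ ω, Real.exp (-∫ s in (0 : ℝ)..t, V (X s ω)) ∂(P t x y)

/-- The heat content `Q_V^{(α)}(t) = ∫∫ (p_t^{H_V}(x,y) - p_t(x,y)) dx dy`. -/
noncomputable def heatContent {d : ℕ} {Ω : Type*} [MeasurableSpace Ω] (α : ℝ)
    (X : ℝ → Ω → EuclideanSpace ℝ (Fin d))
    (P : ℝ → EuclideanSpace ℝ (Fin d) → EuclideanSpace ℝ (Fin d) → Measure Ω)
    (V : EuclideanSpace ℝ (Fin d) → ℝ) (t : ℝ) : ℝ :=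
  ∫ y, ∫ x, (schrodingerKernel α X P V t x y - stableDensity α t (x - y))

/-!
The expansion is the second order Taylor expansion of `e^{-A}`, `A = ∫_0^t V(X_s) ds`, under the
bridge expectation, integrated over the endpoints.

Integrating the finite-dimensional densities `p_{s_1}(x - z_1) ⋯ p_{t - s_n}(z_n - y)` over `x` and
`y` removes the first and the last factor, since every `p_s` has mass one
(`lintegral_lintegral_endpoints`). Hence `∫∫ p_t(x-y) E[∫_0^t f(X_s) ds] dx dy = t ∫ f`
(`integral_bridgeMean_occupation`), which for `f = V` is the linear term. For the quadratic term,
`A² - t ∫_0^t V(X_s)² ds` is the double time integral of `V(X_s) (V(X_r) - V(X_s))`; the Hölder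
condition bounds its contribution by the `γ`-th moment of `p_{|r-s|}`, which is at most
`K |r-s|^{γ/α}` (`lintegral_enorm_bridgeMean_sq_sub_le`), while `f = V²` in the identity above
gives the main part. The cubic Taylor remainder is at most `(t‖V‖_∞)² e^{t‖V‖_∞} ∫_0^t |V(X_s)| ds`,
whose contribution is again computed by that identity.

The facts about `p_t` come from Fourier analysis. Positivity holds because a bridge exists between
any two points, so that `p_t` has no zeros, and `p_t(0) > 0`. A continuous function with
nonnegative Fourier transform has an integrable one, so Fourier inversion gives total mass one
and the characteristic function `e^{-t|ξ|^α}`; the flatness of the latter at the origin yields the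
tail bound `P(|X_t| > r) ≤ c t r^{-α}` and, by the layer cake formula, the moment bound
(`lintegral_norm_rpow_stableMeasure_le`).

The family of bridge measures is not assumed to depend measurably on the endpoints. Measurability
of the integrands is recovered from the finite-dimensional laws by expanding `e^{-A}` into its power
series and each `A^k` into an integral over `k` times (`measurable_integral_bridge_pow`).
-/

/-! ### Fourier analysis of the stable density -/

open scoped FourierTransform in
/-- A function on a finite-dimensional space that is continuous at the origin and has a nonnegative
Fourier transform has an integrable Fourier transform: testing against wide Gaussians bounds
`∫ g` by `f 0`. -/
theorem integrable_of_fourier_eq_nonneg {E : Type*} [NormedAddCommGroup E] [InnerProductSpace ℝ E]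
    [MeasurableSpace E] [BorelSpace E] [FiniteDimensional ℝ E] {f : E → ℂ} {g : E → ℝ}
    (hf : Integrable f) (hf0 : ContinuousAt f 0) (hg : Continuous g) (hg0 : ∀ x, 0 ≤ g x)
    (hfg : ∀ x, 𝓕 f x = (g x : ℂ)) : Integrable g := by
  have hbd : ∀ x, g x ≤ ∫ v, ‖f v‖ := by
    intro x
    have h := VectorFourier.norm_fourierIntegral_le_integral_norm Real.fourierChar volume
      (innerₗ E) f x
    have h2 : ‖𝓕 f x‖ ≤ ∫ v, ‖f v‖ := h
    rw [hfg x, Complex.norm_real, Real.norm_of_nonneg (hg0 x)] at h2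
    exact h2
  have hA : Tendsto (fun c : ℝ => ((∫ x, Real.exp (-c⁻¹ * ‖x‖ ^ 2) * g x : ℝ) : ℂ)) atTop
      (𝓝 (f 0)) := by
    refine (Real.tendsto_integral_gaussian_smul' hf hf0).congr' ?_
    filter_upwards [Ioi_mem_atTop 0] with c (hc : 0 < c)
    have J : Integrable (fun w : E => Complex.exp (-((c⁻¹ : ℝ) : ℂ) * ‖w‖ ^ 2)) := by
      have := GaussianFourier.integrable_cexp_neg_mul_sq_norm_add (V := E)
        (b := ((c⁻¹ : ℝ) : ℂ)) (by simpa) 0 0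
      simpa using this
    have h1 := (VectorFourier.integral_fourierIntegral_smul_eq_flip (L := innerₗ E)
      Real.continuous_fourierChar continuous_inner J hf)
    have h2 : ∫ ξ, 𝓕 (fun w : E => Complex.exp (-((c⁻¹ : ℝ) : ℂ) * ‖w‖ ^ 2)) ξ • f ξ =
        ∫ x, Complex.exp (-((c⁻¹ : ℝ) : ℂ) * ‖x‖ ^ 2) • 𝓕 f x := by
      simpa using! h1
    rw [← integral_complex_ofReal]
    trans ∫ x, Complex.exp (-((c⁻¹ : ℝ) : ℂ) * ‖x‖ ^ 2) • 𝓕 f x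
    · rw [← h2]
      congr with w
      rw [fourier_gaussian_innerProductSpace (by simpa)]
      congr 2
      · simp
      · simp; ring_nf
    · congr with w
      rw [hfg w]
      push_cast
      simp
  have hB : Tendsto (fun c : ℝ => ∫ x, Real.exp (-c⁻¹ * ‖x‖ ^ 2) * g x) atTop
      (𝓝 (f 0).re) := by
    have := (Complex.continuous_re.tendsto _).comp hA
    simpa [Function.comp_def] using this
  refine ⟨hg.aestronglyMeasurable, ?_⟩
  rw [hasFiniteIntegral_iff_ofReal (Eventually.of_forall hg0)]
  have hF := lintegral_liminf_le (μ := (volume : Measure E)) (u := (atTop : Filter ℝ))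
    (f := fun c x => ENNReal.ofReal (Real.exp (-c⁻¹ * ‖x‖ ^ 2) * g x))
    (fun c => by have := hg.measurable; fun_prop)
  have hL : ∀ x, liminf (fun c : ℝ => ENNReal.ofReal (Real.exp (-c⁻¹ * ‖x‖ ^ 2) * g x)) atTop
      = ENNReal.ofReal (g x) := by
    intro x
    refine Tendsto.liminf_eq (ENNReal.tendsto_ofReal ?_)
    have : Tendsto (fun c : ℝ => Real.exp (-c⁻¹ * ‖x‖ ^ 2) * g x) atTop
        (𝓝 (Real.exp (-0 * ‖x‖ ^ 2) * g x)) :=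
      (((tendsto_inv_atTop_zero.neg).mul_const _).rexp).mul_const _
    simpa using this
  have hR : Tendsto (fun c : ℝ => ∫⁻ x, ENNReal.ofReal (Real.exp (-c⁻¹ * ‖x‖ ^ 2) * g x)) atTop
      (𝓝 (ENNReal.ofReal (f 0).re)) := by
    refine (ENNReal.tendsto_ofReal hB).congr' ?_
    filter_upwards [Ioi_mem_atTop 0] with c (hc : 0 < c)
    refine ofReal_integral_eq_lintegral_ofReal ?_ (Eventually.of_forall fun x => by
      have := hg0 x; positivity)
    have J : Integrable (fun w : E => Complex.exp (-((c⁻¹ : ℝ) : ℂ) * ‖w‖ ^ 2)) := by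
      have := GaussianFourier.integrable_cexp_neg_mul_sq_norm_add (V := E)
        (b := ((c⁻¹ : ℝ) : ℂ)) (by simpa) 0 0
      simpa using this
    refine Integrable.mul_bdd (c := ∫ v, ‖f v‖) ?_ hg.aestronglyMeasurable
      (Eventually.of_forall fun x => by
        rw [Real.norm_of_nonneg (hg0 x)]; exact hbd x)
    refine J.norm.congr (Eventually.of_forall fun x => ?_)
    simp only [Complex.norm_exp]
    norm_cast
  simp_rw [hL] at hF
  rw [hR.liminf_eq] at hF
  exact hF.trans_lt ENNReal.ofReal_lt_top

theorem integrable_exp_neg_mul_norm_rpow {E : Type*} [NormedAddCommGroup E] [NormedSpace ℝ E]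
    [MeasurableSpace E] [BorelSpace E] [FiniteDimensional ℝ E] [Nontrivial E] (μ : Measure E)
    [μ.IsAddHaarMeasure] {α t : ℝ} (hα : 0 < α) (ht : 0 < t) :
    Integrable (fun ξ : E => Real.exp (-t * ‖ξ‖ ^ α)) μ := by
  rw [integrable_fun_norm_addHaar μ (f := fun r => Real.exp (-t * r ^ α))]
  have h := integral_rpow_mul_exp_neg_mul_rpow (p := α)
    (q := ((Module.finrank ℝ E - 1 : ℕ) : ℝ)) (b := t) hα
    (by linarith [Nat.cast_nonneg (α := ℝ) (Module.finrank ℝ E - 1)]) ht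
  have hpos : 0 < t ^ (-(((Module.finrank ℝ E - 1 : ℕ) : ℝ) + 1) / α) * (1 / α) *
      Real.Gamma ((((Module.finrank ℝ E - 1 : ℕ) : ℝ) + 1) / α) := by
    have := Real.Gamma_pos_of_pos (s := (((Module.finrank ℝ E - 1 : ℕ) : ℝ) + 1) / α)
      (by positivity)
    positivity
  -- a function with nonzero Bochner integral is integrable
  have hi := Integrable.of_integral_ne_zero (h ▸ hpos.ne')
  refine Integrable.congr hi (Eventually.of_forall fun x => ?_)
  simp [Real.rpow_natCast]

section Density

variable {d : ℕ} {α t : ℝ}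

theorem integrable_exp_neg_mul_norm_rpow_euclideanSpace (hd : 1 ≤ d) (hα : 0 < α) (ht : 0 < t) :
    Integrable (fun ξ : EuclideanSpace ℝ (Fin d) => Real.exp (-t * ‖ξ‖ ^ α)) := by
  have : Nonempty (Fin d) := ⟨⟨0, hd⟩⟩
  exact integrable_exp_neg_mul_norm_rpow _ hα ht

theorem continuous_exp_neg_mul_norm_rpow {E : Type*} [SeminormedAddCommGroup E] (hα : 0 < α) :
    Continuous (fun ξ : E => Real.exp (-t * ‖ξ‖ ^ α)) := by
  have : Continuous (fun ξ : E => ‖ξ‖ ^ α) := continuous_norm.rpow_const fun _ => Or.inr hα.le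
  fun_prop

/-- The function `v ↦ exp (-t |2πv|^α)`, whose Fourier transform in Mathlib's normalisation
`𝓕 f(w) = ∫ e^{-2πi v·w} f(v) dv` is the stable density. -/
noncomputable def stableSymbol (d : ℕ) (α t : ℝ) (v : EuclideanSpace ℝ (Fin d)) : ℂ :=
  (Real.exp (-t * ‖(2 * Real.pi) • v‖ ^ α) : ℝ)

theorem continuous_stableSymbol (hα : 0 < α) : Continuous (stableSymbol d α t) := by
  unfold stableSymbol
  exact Complex.continuous_ofReal.comp
    ((continuous_exp_neg_mul_norm_rpow (t := t) hα).comp (continuous_const_smul _))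

theorem integrable_stableSymbol (hd : 1 ≤ d) (hα : 0 < α) (ht : 0 < t) :
    Integrable (stableSymbol d α t) := by
  unfold stableSymbol
  exact ((integrable_exp_neg_mul_norm_rpow_euclideanSpace hd hα ht).comp_smul
    (by positivity : (2 * Real.pi) ≠ 0)).ofReal

open scoped FourierTransform in
theorem fourier_stableSymbol (hd : 1 ≤ d) (hα : 0 < α) (ht : 0 < t)
    (z : EuclideanSpace ℝ (Fin d)) :
    𝓕 (stableSymbol d α t) z = (stableDensity α t z : ℂ) := by
  have hint := integrable_stableSymbol hd hα ht
  have hbd : ∀ s : ℝ, Integrable (fun v : EuclideanSpace ℝ (Fin d) =>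
      Complex.exp ((s * inner ℝ v z : ℝ) * Complex.I) • stableSymbol d α t v) := by
    intro s
    refine hint.bdd_mul (c := 1) (by
      refine Continuous.aestronglyMeasurable ?_
      fun_prop) (Eventually.of_forall fun v => ?_)
    rw [Complex.norm_exp_ofReal_mul_I]
  have h1 := hbd (-2 * Real.pi)
  have h2 := hbd (2 * Real.pi)
  have hsymm : ∫ v, Complex.exp ((2 * Real.pi * inner ℝ v z : ℝ) * Complex.I) •
        stableSymbol d α t v =
      ∫ v, Complex.exp ((-2 * Real.pi * inner ℝ v z : ℝ) * Complex.I) • stableSymbol d α t v := by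
    rw [← integral_neg_eq_self]
    congr with v
    simp [stableSymbol]
  have hsum : 2 * 𝓕 (stableSymbol d α t) z =
      2 * ∫ v, ((Real.cos (inner ℝ z ((2 * Real.pi) • v)) *
        Real.exp (-t * ‖(2 * Real.pi) • v‖ ^ α) : ℝ) : ℂ) := by
    rw [two_mul, Real.fourier_eq']
    nth_rw 2 [← hsymm]
    rw [← integral_add h1 h2, ← integral_const_mul]
    congr with v
    have hcos := Complex.two_cos ((inner ℝ z ((2 * Real.pi) • v) : ℝ) : ℂ)
    push_cast at hcos ⊢
    rw [← mul_assoc, hcos, stableSymbol, inner_smul_right, real_inner_comm]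
    push_cast
    simp only [smul_eq_mul, ← add_mul]
    congr 1
    rw [add_comm]
    congr 2
    ring
  have h3 := mul_left_cancel₀ two_ne_zero hsum
  rw [h3, integral_complex_ofReal, stableDensity,
    Measure.integral_comp_smul volume (fun ξ : EuclideanSpace ℝ (Fin d) =>
      Real.cos (inner ℝ z ξ) * Real.exp (-t * ‖ξ‖ ^ α)) (2 * Real.pi)]
  congr 1
  rw [finrank_euclideanSpace_fin, smul_eq_mul, abs_of_pos (by positivity)]

theorem continuous_stableDensity (hd : 1 ≤ d) (hα : 0 < α) (ht : 0 < t) :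
    Continuous (stableDensity (d := d) α t) := by
  unfold stableDensity
  refine continuous_const.mul ?_
  refine continuous_of_dominated (bound := fun ξ => Real.exp (-t * ‖ξ‖ ^ α)) (fun z => ?_)
    (fun z => Eventually.of_forall fun ξ => ?_)
    (integrable_exp_neg_mul_norm_rpow_euclideanSpace hd hα ht)
    (Eventually.of_forall fun ξ => by fun_prop)
  · have := continuous_exp_neg_mul_norm_rpow (E := EuclideanSpace ℝ (Fin d)) (t := t) hα
    exact Continuous.aestronglyMeasurable (by fun_prop)
  · rw [norm_mul, Real.norm_eq_abs, Real.norm_eq_abs, Real.abs_exp]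
    exact mul_le_of_le_one_left (Real.exp_pos _).le (Real.abs_cos_le_one _)

/-- The stable density is jointly measurable in time and space. -/
theorem measurable_stableDensity :
    Measurable (fun p : ℝ × EuclideanSpace ℝ (Fin d) => stableDensity α p.1 p.2) := by
  unfold stableDensity
  refine Measurable.const_mul ?_ _
  refine (StronglyMeasurable.integral_prod_right (f := fun (p : ℝ × EuclideanSpace ℝ (Fin d)) ξ =>
    Real.cos (inner ℝ p.2 ξ) * Real.exp (-p.1 * ‖ξ‖ ^ α)) ?_).measurable
  refine Measurable.stronglyMeasurable ?_
  unfold Function.uncurry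
  fun_prop

theorem stableDensity_zero_pos (hd : 1 ≤ d) (hα : 0 < α) (ht : 0 < t) :
    0 < stableDensity α t (0 : EuclideanSpace ℝ (Fin d)) := by
  unfold stableDensity
  refine mul_pos (by positivity) ?_
  simp only [inner_zero_left, Real.cos_zero, one_mul]
  exact integral_exp_pos (integrable_exp_neg_mul_norm_rpow_euclideanSpace hd hα ht)

/-- A stable density without zeros is positive, by continuity and connectedness. -/
theorem stableDensity_pos_of_ne_zero (hd : 1 ≤ d) (hα : 0 < α) (ht : 0 < t)
    (h : ∀ z : EuclideanSpace ℝ (Fin d), stableDensity α t z ≠ 0)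
    (z : EuclideanSpace ℝ (Fin d)) : 0 < stableDensity α t z := by
  by_contra hz
  obtain ⟨w, hw⟩ := mem_range_of_exists_le_of_exists_ge (continuous_stableDensity hd hα ht)
    ⟨z, not_lt.1 hz⟩ ⟨0, (stableDensity_zero_pos hd hα ht).le⟩
  exact h w hw

theorem integrable_stableDensity (hd : 1 ≤ d) (hα : 0 < α) (ht : 0 < t)
    (h : ∀ z : EuclideanSpace ℝ (Fin d), 0 ≤ stableDensity α t z) :
    Integrable (stableDensity (d := d) α t) :=
  integrable_of_fourier_eq_nonneg (integrable_stableSymbol hd hα ht)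
    (continuous_stableSymbol hα).continuousAt (continuous_stableDensity hd hα ht) h
    (fourier_stableSymbol hd hα ht)

open scoped FourierTransform in
/-- The Fourier transform of the stable density, which recovers the defining normalisation. -/
theorem integral_exp_mul_stableDensity (hd : 1 ≤ d) (hα : 0 < α) (ht : 0 < t)
    (h : ∀ z : EuclideanSpace ℝ (Fin d), 0 ≤ stableDensity α t z)
    (ξ : EuclideanSpace ℝ (Fin d)) :
    ∫ z, Complex.exp ((inner ℝ z ξ : ℝ) * Complex.I) * (stableDensity α t z : ℂ) =
      (Real.exp (-t * ‖ξ‖ ^ α) : ℝ) := by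
  have hF : 𝓕 (stableSymbol d α t) = fun z => (stableDensity α t z : ℂ) :=
    funext (fourier_stableSymbol hd hα ht)
  have hinv := congrFun (Continuous.fourierInv_fourier_eq (continuous_stableSymbol (t := t) hα)
    (integrable_stableSymbol hd hα ht)
    (by rw [hF]; exact (integrable_stableDensity hd hα ht h).ofReal)) ((2 * Real.pi)⁻¹ • ξ)
  have h2 : (2 * Real.pi) ≠ 0 := by positivity
  rw [hF, Real.fourierInv_eq', stableSymbol, smul_inv_smul₀ h2] at hinv
  rw [← hinv]
  congr with z
  rw [inner_smul_right, smul_eq_mul, mul_inv_cancel_left₀ h2]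

/-- The law of the rotationally invariant stable process at time `t`, started at the origin. -/
noncomputable def stableMeasure (d : ℕ) (α t : ℝ) : Measure (EuclideanSpace ℝ (Fin d)) :=
  volume.withDensity (fun z => ENNReal.ofReal (stableDensity α t z))

theorem charFun_stableMeasure (hd : 1 ≤ d) (hα : 0 < α) (ht : 0 < t)
    (h : ∀ z : EuclideanSpace ℝ (Fin d), 0 ≤ stableDensity α t z)
    (ξ : EuclideanSpace ℝ (Fin d)) :
    charFun (stableMeasure d α t) ξ = (Real.exp (-t * ‖ξ‖ ^ α) : ℝ) := by
  have hm := (continuous_stableDensity (d := d) hd hα ht).measurable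
  rw [← integral_exp_mul_stableDensity hd hα ht h, charFun_apply, stableMeasure,
    integral_withDensity_eq_integral_toReal_smul hm.ennreal_ofReal
      (Eventually.of_forall fun _ => ENNReal.ofReal_lt_top)]
  congr with z
  rw [ENNReal.toReal_ofReal (h z), Complex.real_smul, mul_comm]

theorem lintegral_stableDensity (hd : 1 ≤ d) (hα : 0 < α) (ht : 0 < t)
    (h : ∀ z : EuclideanSpace ℝ (Fin d), 0 ≤ stableDensity α t z) :
    ∫⁻ z : EuclideanSpace ℝ (Fin d), ENNReal.ofReal (stableDensity α t z) = 1 := by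
  have h1 := integral_exp_mul_stableDensity hd hα ht h 0
  simp only [inner_zero_right, Complex.ofReal_zero, zero_mul, Complex.exp_zero, one_mul,
    norm_zero, Real.zero_rpow hα.ne', mul_zero, Real.exp_zero] at h1
  rw [integral_complex_ofReal] at h1
  rw [← ofReal_integral_eq_lintegral_ofReal (integrable_stableDensity hd hα ht h)
    (Eventually.of_forall h), Complex.ofReal_injective h1, ENNReal.ofReal_one]

theorem isProbabilityMeasure_stableMeasure (hd : 1 ≤ d) (hα : 0 < α) (ht : 0 < t)
    (h : ∀ z : EuclideanSpace ℝ (Fin d), 0 ≤ stableDensity α t z) :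
    IsProbabilityMeasure (stableMeasure d α t) :=
  ⟨by rw [stableMeasure, withDensity_apply _ MeasurableSet.univ, setLIntegral_univ,
    lintegral_stableDensity hd hα ht h]⟩

end Density

/-! ### Moments of the stable law -/

section Moment

variable {d : ℕ} {α t : ℝ}

/-- Tail bound for one direction, from the flatness `|1 - e^{-t|u|^α}| ≤ t|u|^α` of the
characteristic function at the origin. -/
theorem stableMeasure_real_inner_gt_le (hd : 1 ≤ d) (hα : 0 < α) (ht : 0 < t)
    (h : ∀ z : EuclideanSpace ℝ (Fin d), 0 ≤ stableDensity α t z)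
    {a : EuclideanSpace ℝ (Fin d)} (ha : ‖a‖ = 1) {r : ℝ} (hr : 0 < r) :
    (stableMeasure d α t).real {x | r < |inner ℝ a x|} ≤ 2 * t * (2 / r) ^ α := by
  have := isProbabilityMeasure_stableMeasure hd hα ht h
  refine (measureReal_abs_inner_gt_le_integral_charFun hr).trans ?_
  have hb : ‖∫ u in (-2 * r⁻¹)..(2 * r⁻¹), 1 - charFun (stableMeasure d α t) (u • a)‖ ≤
      t * (2 / r) ^ α * |2 * r⁻¹ - (-2 * r⁻¹)| := by
    refine intervalIntegral.norm_integral_le_of_norm_le_const fun u hu => ?_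
    rw [charFun_stableMeasure hd hα ht h, norm_smul, ha, mul_one, Real.norm_eq_abs]
    have hu' : |u| ≤ 2 / r := by
      rw [Set.uIoc_of_le (by have := inv_pos.2 hr; linarith)] at hu
      rw [abs_le, div_eq_mul_inv]
      exact ⟨by linarith [hu.1], hu.2⟩
    have h1 : |u| ^ α ≤ (2 / r) ^ α := Real.rpow_le_rpow (abs_nonneg _) hu' hα.le
    have h0 : 0 ≤ t * |u| ^ α := by positivity
    have h2 := Real.add_one_le_exp (-t * |u| ^ α)
    have h3 : Real.exp (-t * |u| ^ α) ≤ 1 := Real.exp_le_one_iff.2 (by linarith)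
    rw [← Complex.ofReal_one, ← Complex.ofReal_sub, Complex.norm_real, Real.norm_of_nonneg
      (by linarith)]
    nlinarith
  calc 2⁻¹ * r * _ ≤ 2⁻¹ * r * (t * (2 / r) ^ α * |2 * r⁻¹ - (-2 * r⁻¹)|) := by gcongr
    _ = 2 * t * (2 / r) ^ α := by
      rw [abs_of_nonneg (by have := inv_pos.2 hr; linarith)]
      field_simp
      ring

theorem stableMeasure_norm_gt_le (hd : 1 ≤ d) (hα : 0 < α) (ht : 0 < t)
    (h : ∀ z : EuclideanSpace ℝ (Fin d), 0 ≤ stableDensity α t z) {r : ℝ} (hr : 0 < r) :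
    stableMeasure d α t {x | r < ‖x‖} ≤
      ENNReal.ofReal (2 * d * (2 * d) ^ α * t * r ^ (-α)) := by
  have := isProbabilityMeasure_stableMeasure hd hα ht h
  have hd0 : (0 : ℝ) < d := by exact_mod_cast hd
  have hsub : {x : EuclideanSpace ℝ (Fin d) | r < ‖x‖} ⊆
      ⋃ i : Fin d, {x | r / d < |inner ℝ (EuclideanSpace.single i (1 : ℝ)) x|} := by
    intro x hx
    by_contra hc
    simp only [Set.mem_iUnion, Set.mem_ofPred_eq, not_exists, not_lt] at hc hx
    have h1 : ‖x‖ ≤ ∑ i, ‖inner ℝ (EuclideanSpace.single i (1 : ℝ)) x‖ := by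
      have h2 := (EuclideanSpace.basisFun (Fin d) ℝ).sum_repr' x
      nth_rw 1 [← h2]
      refine (norm_sum_le _ _).trans (Finset.sum_le_sum fun i _ => ?_)
      rw [norm_smul]
      simp
    have h2 : ∑ i : Fin d, ‖inner ℝ (EuclideanSpace.single i (1 : ℝ)) x‖ ≤
        ∑ i : Fin d, r / d := Finset.sum_le_sum fun i _ => hc i
    rw [Finset.sum_const, Finset.card_univ, Fintype.card_fin, nsmul_eq_mul,
      mul_div_cancel₀ _ hd0.ne'] at h2
    linarith
  refine (measure_mono hsub).trans ((measure_iUnion_le _).trans ?_)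
  rw [tsum_fintype]
  have hi : ∀ i : Fin d, stableMeasure d α t
      {x | r / d < |inner ℝ (EuclideanSpace.single i (1 : ℝ)) x|} ≤
        ENNReal.ofReal (2 * t * (2 / (r / d)) ^ α) := by
    intro i
    rw [← ofReal_measureReal]
    exact ENNReal.ofReal_le_ofReal
      (stableMeasure_real_inner_gt_le hd hα ht h (by simp) (by positivity))
  refine (Finset.sum_le_sum fun i _ => hi i).trans ?_
  rw [Finset.sum_const, Finset.card_univ, Fintype.card_fin, nsmul_eq_mul,
    ← ENNReal.ofReal_natCast, ← ENNReal.ofReal_mul (by positivity)]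
  refine ENNReal.ofReal_le_ofReal (le_of_eq ?_)
  have : 2 / (r / d) = 2 * d * r⁻¹ := by field_simp
  rw [this, Real.mul_rpow (by positivity) (by positivity), Real.inv_rpow hr.le,
    ← Real.rpow_neg hr.le]
  ring

/-- The constant in the moment bound `E|X_t|^γ ≤ K t^{γ/α}` for the stable process. -/
noncomputable def stableMomentConst (d : ℕ) (α γ : ℝ) : ℝ :=
  1 + γ * (2 * d * (2 * d) ^ α) / (α - γ)

theorem stableMomentConst_nonneg {γ : ℝ} (hγ : 0 < γ) (hγα : γ < α) :
    0 ≤ stableMomentConst d α γ := by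
  have := sub_pos.2 hγα
  unfold stableMomentConst
  positivity

/-- The moment bound `E|X_t|^γ ≤ K t^{γ/α}` for `0 < γ < α`: the layer cake formula, split at the
natural length scale `t^{1/α}`. -/
theorem lintegral_norm_rpow_stableMeasure_le {γ : ℝ} (hd : 1 ≤ d) (hα : 0 < α) (ht : 0 < t)
    (hγ : 0 < γ) (hγα : γ < α)
    (h : ∀ z : EuclideanSpace ℝ (Fin d), 0 ≤ stableDensity α t z) :
    ∫⁻ z, ENNReal.ofReal (‖z‖ ^ γ) ∂(stableMeasure d α t) ≤
      ENNReal.ofReal (stableMomentConst d α γ * t ^ (γ / α)) := by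
  have := isProbabilityMeasure_stableMeasure hd hα ht h
  set κ : ℝ := 2 * d * (2 * d) ^ α with hκ
  have hκ0 : 0 ≤ κ := by positivity
  set R : ℝ := t ^ (1 / α) with hR
  have hR0 : 0 < R := by positivity
  have hαγ : 0 < α - γ := sub_pos.2 hγα
  rw [lintegral_rpow_eq_lintegral_meas_lt_mul _ (Eventually.of_forall fun z => norm_nonneg z)
    (by fun_prop) hγ, ← Set.Ioc_union_Ioi_eq_Ioi hR0.le]
  have hsmall : ∫⁻ r in Set.Ioc 0 R, stableMeasure d α t {a | r < ‖a‖} *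
      ENNReal.ofReal (r ^ (γ - 1)) ≤ ENNReal.ofReal (R ^ γ / γ) := by
    calc _ ≤ ∫⁻ r in Set.Ioc 0 R, ENNReal.ofReal (r ^ (γ - 1)) := by
          refine lintegral_mono fun r => mul_le_of_le_one_left zero_le prob_le_one
      _ = ENNReal.ofReal (∫ r in (0 : ℝ)..R, r ^ (γ - 1)) := by
          rw [intervalIntegral.integral_of_le hR0.le, ofReal_integral_eq_lintegral_ofReal]
          · exact (intervalIntegrable_iff_integrableOn_Ioc_of_le hR0.le).1
              (intervalIntegral.intervalIntegrable_rpow' (by linarith))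
          · exact (ae_restrict_iff' measurableSet_Ioc).2
              (Eventually.of_forall fun r hr => Real.rpow_nonneg hr.1.le _)
      _ = _ := by
          rw [integral_rpow (Or.inl (by linarith))]
          simp [Real.zero_rpow hγ.ne']
  have hlarge : ∫⁻ r in Set.Ioi R, stableMeasure d α t {a | r < ‖a‖} *
      ENNReal.ofReal (r ^ (γ - 1)) ≤ ENNReal.ofReal (κ * t * (R ^ (γ - α) / (α - γ))) := by
    have hint := integrableOn_Ioi_rpow_of_lt (a := γ - 1 - α) (by linarith) hR0
    calc _ ≤ ∫⁻ r in Set.Ioi R, ENNReal.ofReal (κ * t * r ^ (γ - 1 - α)) := by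
          refine setLIntegral_mono' measurableSet_Ioi fun r hr => ?_
          have hr0 : 0 < r := hR0.trans hr
          refine (mul_le_mul_left (stableMeasure_norm_gt_le hd hα ht h hr0) _).trans ?_
          rw [← ENNReal.ofReal_mul (by positivity), mul_assoc (_ * t), ← Real.rpow_add hr0]
          refine ENNReal.ofReal_le_ofReal (le_of_eq ?_)
          rw [hκ]
          ring_nf
      _ = ENNReal.ofReal (∫ r in Set.Ioi R, κ * t * r ^ (γ - 1 - α)) := by
          rw [ofReal_integral_eq_lintegral_ofReal (hint.const_mul _)]
          refine (ae_restrict_iff' measurableSet_Ioi).2 (Eventually.of_forall fun r hr => ?_)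
          have hr0 : 0 < r := hR0.trans hr
          positivity
      _ = _ := by
          rw [integral_const_mul, integral_Ioi_rpow_of_lt (by linarith) hR0]
          congr 2
          rw [show γ - 1 - α + 1 = -(α - γ) by ring, neg_div_neg_eq, neg_sub]
  refine (mul_le_mul_right ((lintegral_union_le _ _ _).trans (add_le_add hsmall hlarge)) _).trans ?_
  rw [← ENNReal.ofReal_add (by positivity) (by positivity), ← ENNReal.ofReal_mul hγ.le]
  refine ENNReal.ofReal_le_ofReal (le_of_eq ?_)
  have h1 : R ^ γ = t ^ (γ / α) := by rw [hR, ← Real.rpow_mul ht.le]; ring_nf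
  have h2 : t * R ^ (γ - α) = t ^ (γ / α) := by
    rw [hR, ← Real.rpow_mul ht.le]
    nth_rw 1 [← Real.rpow_one t]
    rw [← Real.rpow_add ht]
    congr 1
    field_simp
    ring
  rw [stableMomentConst, ← hκ, h1, mul_assoc κ, ← mul_div_assoc, h2]
  field_simp

end Moment

/-! ### Finite-dimensional laws of the bridge and measurability in the endpoints -/

theorem abs_setIntegral_comp_le {E : Type*} {t : ℝ} (ht : 0 < t) {f : E → ℝ} {B : ℝ}
    (hB : ∀ x, |f x| ≤ B) (γ : ℝ → E) : |∫ s in Set.Ioo 0 t, f (γ s)| ≤ t * B := by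
  have h := norm_setIntegral_le_of_norm_le_const (μ := volume) (s := Set.Ioo (0 : ℝ) t)
    (f := fun s => f (γ s)) (C := B) (by simp) (fun s _ => hB _)
  simpa [Measure.real, ht.le, mul_comm] using h

section Bridge

variable {d : ℕ} {α t : ℝ} {Ω : Type*} [MeasurableSpace Ω]
  {X : ℝ → Ω → EuclideanSpace ℝ (Fin d)}

/-- The density at the endpoint of a bridge does not vanish: the law of the empty family of marginals
is a probability measure, while its density `p_t(x-y) / p_t(x-y)` would be `0 / 0 = 0` otherwise. -/
theorem IsStableBridge.stableDensity_ne_zero {x y : EuclideanSpace ℝ (Fin d)} {P : Measure Ω}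
    (h : IsStableBridge α t x y X P) : stableDensity α t (x - y) ≠ 0 := by
  intro h0
  have := h.isProbabilityMeasure
  have hl := h.law 0 Fin.elim0 (fun i => i.elim0) (fun i => i.elim0)
  have h1 := congrArg (fun μ => μ Set.univ) hl
  have hm : Measurable fun (ω : Ω) (i : Fin 0) => X (Fin.elim0 i : ℝ) ω :=
    measurable_pi_lambda _ fun i => i.elim0
  simp [stableBridgeDensity, h0, Measure.map_apply hm MeasurableSet.univ] at h1

theorem IsStableBridge.measurable_apply {x y : EuclideanSpace ℝ (Fin d)} {P : Measure Ω}
    (h : IsStableBridge α t x y X P) (s : ℝ) : Measurable (X s) :=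
  h.measurable.comp measurable_prodMk_left

theorem IsStableBridge.measurable_tuple {x y : EuclideanSpace ℝ (Fin d)} {P : Measure Ω}
    (h : IsStableBridge α t x y X P) {n : ℕ} (s : Fin n → ℝ) :
    Measurable fun (ω : Ω) (i : Fin n) => X (s i) ω :=
  measurable_pi_lambda _ fun i => h.measurable_apply (s i)

theorem measurable_cons_snoc_apply {β γ : Type*} [MeasurableSpace β] [MeasurableSpace γ] {n : ℕ}
    {a c : β → γ} {b : β → Fin n → γ} (ha : Measurable a) (hb : Measurable b) (hc : Measurable c)
    (j : Fin (n + 2)) : Measurable fun q =>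
      (Fin.cons (a q) (Fin.snoc (b q) (c q) : Fin (n + 1) → γ) : Fin (n + 2) → γ) j := by
  refine Fin.cases ?_ (fun j => ?_) j
  · simpa only [Fin.cons_zero] using ha
  · refine Fin.lastCases ?_ (fun j => ?_) j
    · simpa only [Fin.cons_succ, Fin.snoc_last] using hc
    · simp only [Fin.cons_succ, Fin.snoc_castSucc]
      exact (measurable_pi_apply j).comp hb

theorem measurable_stableDensity_comp {β : Type*} [MeasurableSpace β] {s : β → ℝ}
    {z : β → EuclideanSpace ℝ (Fin d)} (hs : Measurable s) (hz : Measurable z) :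
    Measurable fun q => stableDensity α (s q) (z q) := by
  have h := (measurable_stableDensity (d := d) (α := α)).comp (hs.prodMk hz)
  exact h

/-- The bridge density is jointly measurable in the endpoints, the times and the positions. -/
theorem measurable_stableBridgeDensity_comp {β : Type*} [MeasurableSpace β] {n : ℕ}
    {x y : β → EuclideanSpace ℝ (Fin d)} {s : β → Fin n → ℝ}
    {z : β → Fin n → EuclideanSpace ℝ (Fin d)} (hx : Measurable x) (hy : Measurable y)
    (hs : Measurable s) (hz : Measurable z) :
    Measurable fun q => stableBridgeDensity α t (x q) (y q) (s q) (z q) := by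
  have hτ := measurable_cons_snoc_apply (measurable_const (a := (0 : ℝ))) hs
    (measurable_const (a := t))
  have hζ := measurable_cons_snoc_apply hx hz hy
  have hden : Measurable fun q => stableDensity α t (x q - y q) :=
    measurable_stableDensity_comp measurable_const (hx.sub hy)
  have hj : ∀ j : Fin (n + 1), Measurable fun q => stableDensity α
      ((Fin.cons 0 (Fin.snoc (s q) t : Fin (n + 1) → ℝ) : Fin (n + 2) → ℝ) j.succ -
        (Fin.cons 0 (Fin.snoc (s q) t : Fin (n + 1) → ℝ) : Fin (n + 2) → ℝ) j.castSucc)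
      ((Fin.cons (x q) (Fin.snoc (z q) (y q) : Fin (n + 1) → EuclideanSpace ℝ (Fin d)) :
          Fin (n + 2) → EuclideanSpace ℝ (Fin d)) j.castSucc -
        (Fin.cons (x q) (Fin.snoc (z q) (y q) : Fin (n + 1) → EuclideanSpace ℝ (Fin d)) :
          Fin (n + 2) → EuclideanSpace ℝ (Fin d)) j.succ) := fun j =>
    measurable_stableDensity_comp ((hτ j.succ).sub (hτ j.castSucc)) ((hζ j.castSucc).sub (hζ j.succ))
  have hnum := Finset.measurable_fun_prod Finset.univ fun j _ => hj j
  exact hnum.div hden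

theorem measurable_stableBridgeDensity_apply (x y : EuclideanSpace ℝ (Fin d)) {n : ℕ}
    (s : Fin n → ℝ) : Measurable (stableBridgeDensity α t x y s) :=
  measurable_stableBridgeDensity_comp measurable_const measurable_const measurable_const measurable_id

theorem IsStableBridge.lintegral_comp {x y : EuclideanSpace ℝ (Fin d)} {P : Measure Ω}
    (h : IsStableBridge α t x y X P) {n : ℕ} {s : Fin n → ℝ} (hs : StrictMono s)
    (hst : ∀ i, 0 < s i ∧ s i < t) {g : (Fin n → EuclideanSpace ℝ (Fin d)) → ℝ≥0∞}
    (hg : Measurable g) :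
    ∫⁻ ω, g (fun i => X (s i) ω) ∂P =
      ∫⁻ z, ENNReal.ofReal (stableBridgeDensity α t x y s z) * g z := by
  rw [← lintegral_map hg (h.measurable_tuple s), h.law n s hs hst,
    lintegral_withDensity_eq_lintegral_mul _
      (measurable_stableBridgeDensity_apply x y s).ennreal_ofReal hg]
  rfl

theorem IsStableBridge.integral_comp {x y : EuclideanSpace ℝ (Fin d)} {P : Measure Ω}
    (h : IsStableBridge α t x y X P) {n : ℕ} {s : Fin n → ℝ} (hs : StrictMono s)
    (hst : ∀ i, 0 < s i ∧ s i < t) {g : (Fin n → EuclideanSpace ℝ (Fin d)) → ℝ}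
    (hg : Measurable g) :
    ∫ ω, g (fun i => X (s i) ω) ∂P =
      ∫ z, (ENNReal.ofReal (stableBridgeDensity α t x y s z)).toReal * g z := by
  rw [← integral_map (h.measurable_tuple s).aemeasurable hg.aestronglyMeasurable,
    h.law n s hs hst, integral_withDensity_eq_integral_toReal_smul
      (measurable_stableBridgeDensity_apply x y s).ennreal_ofReal
      (Eventually.of_forall fun _ => ENNReal.ofReal_lt_top)]
  rfl

/-- Almost every tuple of reals has pairwise distinct entries. -/
theorem ae_injective_pi (k : ℕ) : ∀ᵐ s : Fin k → ℝ, Function.Injective s := by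
  have h : ∀ i j : Fin k, i ≠ j → ∀ᵐ s : Fin k → ℝ, s i ≠ s j := by
    intro i j hij
    have hne : LinearMap.ker ((LinearMap.proj i : (Fin k → ℝ) →ₗ[ℝ] ℝ) - LinearMap.proj j)
        ≠ ⊤ := by
      intro htop
      have : (Pi.single i 1 : Fin k → ℝ) ∈ LinearMap.ker
          ((LinearMap.proj i : (Fin k → ℝ) →ₗ[ℝ] ℝ) - LinearMap.proj j) := htop ▸ trivial
      simp [Pi.single_eq_of_ne hij.symm] at this
    have := Measure.addHaar_submodule (volume : Measure (Fin k → ℝ)) _ hne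
    refine measure_mono_null (fun s hs => ?_) this
    simpa [sub_eq_zero] using hs
  have h' : ∀ᵐ s : Fin k → ℝ, ∀ i j : Fin k, i ≠ j → s i ≠ s j := by
    simpa only [ae_all_iff] using h
  filter_upwards [h'] with s hs i j hij
  by_contra hne
  exact hs i j hne hij

theorem measurableSet_strictMono (k : ℕ) : MeasurableSet {s : Fin k → ℝ | StrictMono s} := by
  have : {s : Fin k → ℝ | StrictMono s} = ⋂ (i : Fin k) (j : Fin k) (_ : i < j), {s | s i < s j} := by
    ext s
    simp [StrictMono]
  rw [this]
  exact MeasurableSet.iInter fun i => MeasurableSet.iInter fun j => MeasurableSet.iInter fun _ =>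
    measurableSet_lt (measurable_pi_apply i) (measurable_pi_apply j)

theorem IsStableBridge.measurable_path {x y : EuclideanSpace ℝ (Fin d)} {P : Measure Ω}
    (h : IsStableBridge α t x y X P) (ω : Ω) : Measurable fun s => X s ω :=
  h.measurable.comp measurable_prodMk_right

/-- The `k`-th moment of `∫_0^t f(X_s) ds` under the bridge measures depends measurably on the
endpoints. No measurability of the family of bridge measures is assumed: the moment is the integral
over `[0,t]^k` of expectations of functions of finitely many marginals, and these have measurable
densities once the times are sorted. -/
theorem measurable_integral_bridge_pow
    {P : EuclideanSpace ℝ (Fin d) → EuclideanSpace ℝ (Fin d) → Measure Ω}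
    (hP : ∀ x y, IsStableBridge α t x y X (P x y)) {f : EuclideanSpace ℝ (Fin d) → ℝ}
    (hf : Measurable f) {B : ℝ} (hB : ∀ x, |f x| ≤ B) (k : ℕ) :
    Measurable (fun q : EuclideanSpace ℝ (Fin d) × EuclideanSpace ℝ (Fin d) =>
      ∫ ω, (∫ s in Set.Ioo 0 t, f (X s ω)) ^ k ∂(P q.1 q.2)) := by
  classical
  set F : EuclideanSpace ℝ (Fin d) × EuclideanSpace ℝ (Fin d) → (Fin k → ℝ) → ℝ := fun q s =>
    ∫ z, (ENNReal.ofReal (stableBridgeDensity α t q.1 q.2 s z)).toReal * ∏ i, f (z i) with hF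
  have hFm : Measurable (Function.uncurry F) := by
    have hm : Measurable (fun p : ((EuclideanSpace ℝ (Fin d) × EuclideanSpace ℝ (Fin d)) ×
        (Fin k → ℝ)) × (Fin k → EuclideanSpace ℝ (Fin d)) =>
        (ENNReal.ofReal (stableBridgeDensity α t p.1.1.1 p.1.1.2 p.1.2 p.2)).toReal *
          ∏ i, f (p.2 i)) := by
      refine Measurable.mul ?_ (Finset.measurable_fun_prod _ fun i _ =>
        hf.comp ((measurable_pi_apply i).comp measurable_snd))
      exact ((measurable_stableBridgeDensity_comp measurable_fst.fst.fst measurable_fst.fst.snd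
        measurable_fst.snd measurable_snd).ennreal_ofReal).ennreal_toReal
    exact (StronglyMeasurable.integral_prod_right
      (f := fun (p : (EuclideanSpace ℝ (Fin d) × EuclideanSpace ℝ (Fin d)) ×
        (Fin k → ℝ)) (z : Fin k → EuclideanSpace ℝ (Fin d)) =>
        (ENNReal.ofReal (stableBridgeDensity α t p.1.1 p.1.2 p.2 z)).toReal *
          ∏ i, f (z i)) hm.stronglyMeasurable).measurable
  set ι : (Fin k → ℝ) → ℝ := {s | StrictMono s}.indicator 1 with hι
  have hιm : Measurable ι := measurable_one.indicator (measurableSet_strictMono k)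
  have hιn : ∀ s, 0 ≤ ι s := fun s => Set.indicator_nonneg (fun _ _ => zero_le_one) s
  -- averaging over all orderings of the times spares a measurable choice of the sorting one
  set H : EuclideanSpace ℝ (Fin d) × EuclideanSpace ℝ (Fin d) → (Fin k → ℝ) → ℝ := fun q s =>
    (∑ σ : Equiv.Perm (Fin k), ι (s ∘ σ) * F q (s ∘ σ)) / ∑ σ : Equiv.Perm (Fin k), ι (s ∘ σ)
    with hH
  have hperm : ∀ σ : Equiv.Perm (Fin k), Measurable (fun s : Fin k → ℝ => s ∘ σ) := fun σ =>
    measurable_pi_lambda _ fun i => measurable_pi_apply _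
  have hHm : Measurable (Function.uncurry H) := by
    have h1 : ∀ σ : Equiv.Perm (Fin k), Measurable fun p : (EuclideanSpace ℝ (Fin d) ×
        EuclideanSpace ℝ (Fin d)) × (Fin k → ℝ) => ι (p.2 ∘ σ) := fun σ =>
      hιm.comp ((hperm σ).comp measurable_snd)
    have h2 : ∀ σ : Equiv.Perm (Fin k), Measurable fun p : (EuclideanSpace ℝ (Fin d) ×
        EuclideanSpace ℝ (Fin d)) × (Fin k → ℝ) => F p.1 (p.2 ∘ σ) := by
      intro σ
      have h := hFm.comp (measurable_fst.prodMk ((hperm σ).comp measurable_snd))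
      exact h
    have h3 := Finset.measurable_fun_sum Finset.univ fun σ _ => (h1 σ).mul (h2 σ)
    have h4 := Finset.measurable_fun_sum Finset.univ fun σ _ => h1 σ
    exact h3.div h4
  set μ : Measure ℝ := volume.restrict (Set.Ioo 0 t) with hμ
  have hae : ∀ᵐ s ∂(Measure.pi fun _ : Fin k => μ),
      Function.Injective s ∧ ∀ i, 0 < s i ∧ s i < t := by
    rw [hμ, ← Measure.restrict_pi_pi]
    refine ((ae_restrict_of_ae (ae_injective_pi k))).and ?_
    filter_upwards [ae_restrict_mem (MeasurableSet.univ_pi fun _ => measurableSet_Ioo)] with s hs i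
    exact hs i trivial
  suffices hkey : (fun q : EuclideanSpace ℝ (Fin d) × EuclideanSpace ℝ (Fin d) =>
      ∫ ω, (∫ s in Set.Ioo 0 t, f (X s ω)) ^ k ∂(P q.1 q.2)) =
      fun q => ∫ s, H q s ∂(Measure.pi fun _ : Fin k => μ) by
    rw [hkey]
    exact (StronglyMeasurable.integral_prod_right hHm.stronglyMeasurable).measurable
  funext q
  have hq := hP q.1 q.2
  have := hq.isProbabilityMeasure
  have hB0 : 0 ≤ B := (abs_nonneg _).trans (hB 0)
  have hjm : Measurable (fun p : Ω × (Fin k → ℝ) => ∏ i, f (X (p.2 i) p.1)) := by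
    refine Finset.measurable_fun_prod _ fun i _ => ?_
    have h : Measurable fun p : Ω × (Fin k → ℝ) => (p.2 i, p.1) := by fun_prop
    exact hf.comp (hq.measurable.comp h)
  calc ∫ ω, (∫ s in Set.Ioo 0 t, f (X s ω)) ^ k ∂(P q.1 q.2)
      = ∫ ω, ∫ s, ∏ i, f (X (s i) ω) ∂(Measure.pi fun _ : Fin k => μ) ∂(P q.1 q.2) := by
        congr with ω
        rw [integral_fintype_prod_eq_pow (ι := Fin k) (fun s => f (X s ω)), Fintype.card_fin]
    _ = ∫ s, ∫ ω, ∏ i, f (X (s i) ω) ∂(P q.1 q.2) ∂(Measure.pi fun _ : Fin k => μ) := by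
        refine integral_integral_swap ?_
        refine Integrable.of_bound (C := B ^ k) hjm.aestronglyMeasurable
          (Eventually.of_forall fun p => ?_)
        simp only [Function.uncurry]
        rw [Real.norm_eq_abs, Finset.abs_prod]
        calc _ ≤ ∏ _i : Fin k, B := Finset.prod_le_prod (fun _ _ => abs_nonneg _) fun _ _ => hB _
          _ = B ^ k := by simp
    _ = ∫ s, H q s ∂(Measure.pi fun _ : Fin k => μ) := by
        refine integral_congr_ae ?_
        filter_upwards [hae] with s ⟨hinj, hst⟩
        have hterm : ∀ σ : Equiv.Perm (Fin k), ι (s ∘ σ) * F q (s ∘ σ) =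
            ι (s ∘ σ) * ∫ ω, ∏ i, f (X (s i) ω) ∂(P q.1 q.2) := by
          intro σ
          by_cases hσ : StrictMono (s ∘ σ)
          · congr 1
            have h1 := hq.integral_comp hσ (fun i => hst (σ i))
              (g := fun z => ∏ i, f (z i))
              (Finset.measurable_fun_prod _ fun i _ => by fun_prop)
            rw [hF]
            simp only
            rw [← h1]
            congr with ω
            exact Equiv.prod_comp σ (fun i => f (X (s i) ω))
          · have h0 : ι (s ∘ σ) = 0 := Set.indicator_of_notMem hσ _
            rw [h0, zero_mul, zero_mul]
        have hpos : 0 < ∑ σ : Equiv.Perm (Fin k), ι (s ∘ σ) := by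
          refine Finset.sum_pos' (fun σ _ => hιn _) ⟨Tuple.sort s, Finset.mem_univ _, ?_⟩
          have hmem : StrictMono (s ∘ Tuple.sort s) :=
            (Tuple.monotone_sort s).strictMono_of_injective
              (hinj.comp (Tuple.sort s).injective)
          have h1 : ι (s ∘ Tuple.sort s) = 1 := Set.indicator_of_mem hmem _
          rw [h1]
          exact one_pos
        rw [hH]
        simp only [hterm]
        rw [← Finset.sum_mul, mul_div_cancel_left₀ _ hpos.ne']

/-- The integral `∫_0^t f(X_s) ds` is a random variable. -/
theorem IsStableBridge.measurable_setIntegral_path {x y : EuclideanSpace ℝ (Fin d)} {P : Measure Ω}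
    (h : IsStableBridge α t x y X P) {f : EuclideanSpace ℝ (Fin d) → ℝ} (hf : Measurable f) :
    Measurable fun ω => ∫ s in Set.Ioo 0 t, f (X s ω) :=
  (StronglyMeasurable.integral_prod_right (f := fun ω s => f (X s ω))
    (hf.comp (h.measurable.comp measurable_swap)).stronglyMeasurable).measurable

/-- The expectation of `exp (-∫_0^t f(X_s) ds)` depends measurably on the endpoints of the bridge:
it is the limit of its exponential series. -/
theorem measurable_integral_bridge_exp (ht : 0 < t)
    {P : EuclideanSpace ℝ (Fin d) → EuclideanSpace ℝ (Fin d) → Measure Ω}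
    (hP : ∀ x y, IsStableBridge α t x y X (P x y)) {f : EuclideanSpace ℝ (Fin d) → ℝ}
    (hf : Measurable f) {B : ℝ} (hB : ∀ x, |f x| ≤ B) :
    Measurable (fun q : EuclideanSpace ℝ (Fin d) × EuclideanSpace ℝ (Fin d) =>
      ∫ ω, Real.exp (-∫ s in Set.Ioo 0 t, f (X s ω)) ∂(P q.1 q.2)) := by
  refine measurable_of_tendsto_metrizable (f := fun (n : ℕ) q => ∑ k ∈ Finset.range n,
    (-1) ^ k / k.factorial * ∫ ω, (∫ s in Set.Ioo 0 t, f (X s ω)) ^ k ∂(P q.1 q.2))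
    (fun n => Finset.measurable_fun_sum _ fun k _ =>
      (measurable_integral_bridge_pow hP hf hB k).const_mul _) ?_
  rw [tendsto_pi_nhds]
  intro q
  have hq := hP q.1 q.2
  have := hq.isProbabilityMeasure
  have hm := hq.measurable_setIntegral_path hf
  have hb : ∀ ω, |∫ s in Set.Ioo 0 t, f (X s ω)| ≤ t * B :=
    fun ω => abs_setIntegral_comp_le ht hB fun s => X s ω
  set A : Ω → ℝ := fun ω => ∫ s in Set.Ioo 0 t, f (X s ω) with hA
  have hint : ∀ k : ℕ, Integrable (fun ω => A ω ^ k) (P q.1 q.2) := fun k =>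
    Integrable.of_bound (C := (t * B) ^ k) (hm.pow_const k).aestronglyMeasurable
      (Eventually.of_forall fun ω => by
        rw [norm_pow]
        exact pow_le_pow_left₀ (norm_nonneg _) (hb ω) k)
  have hsum : ∀ n : ℕ, ∑ k ∈ Finset.range n,
      (-1) ^ k / k.factorial * ∫ ω, A ω ^ k ∂(P q.1 q.2) =
      ∫ ω, ∑ k ∈ Finset.range n, (-A ω) ^ k / k.factorial ∂(P q.1 q.2) := by
    intro n
    rw [integral_finsetSum]
    · refine Finset.sum_congr rfl fun k _ => ?_
      rw [← integral_const_mul]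
      congr with ω
      rw [neg_pow]
      ring
    · intro k _
      refine ((hint k).const_mul ((-1) ^ k / k.factorial)).congr
        (Eventually.of_forall fun ω => ?_)
      beta_reduce
      rw [neg_pow (A ω)]
      ring
  refine Tendsto.congr (fun n => (hsum n).symm) ?_
  refine tendsto_integral_of_dominated_convergence (fun _ => Real.exp (t * B)) (fun n => ?_)
    (integrable_const _) (fun n => Eventually.of_forall fun ω => ?_)
    (Eventually.of_forall fun ω => ?_)
  · have h := Finset.measurable_fun_sum (Finset.range n) fun k _ =>
      (hm.neg.pow_const k).div_const (k.factorial : ℝ)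
    exact h.aestronglyMeasurable
  · calc ‖∑ k ∈ Finset.range n, (-A ω) ^ k / k.factorial‖
        ≤ ∑ k ∈ Finset.range n, |A ω| ^ k / k.factorial := by
          refine (norm_sum_le _ _).trans (le_of_eq (Finset.sum_congr rfl fun k _ => ?_))
          rw [norm_div, norm_pow, norm_neg, Real.norm_eq_abs, Real.norm_natCast]
      _ ≤ Real.exp |A ω| := Real.sum_le_exp_of_nonneg (abs_nonneg _) n
      _ ≤ Real.exp (t * B) := Real.exp_le_exp.2 (hb ω)
  · have := (NormedSpace.expSeries_div_hasSum_exp (𝔸 := ℝ) (-A ω)).tendsto_sum_nat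
    rwa [← Real.exp_eq_exp_ℝ] at this

end Bridge

/-! ### Integrating out the endpoints -/

section LIntegral

variable {d : ℕ} {α t : ℝ} {Ω : Type*} [MeasurableSpace Ω]
  {X : ℝ → Ω → EuclideanSpace ℝ (Fin d)}

theorem stableBridgeDensity_one (x y : EuclideanSpace ℝ (Fin d)) (s : ℝ)
    (z : Fin 1 → EuclideanSpace ℝ (Fin d)) :
    stableBridgeDensity α t x y (fun _ : Fin 1 => s) z =
      stableDensity α s (x - z 0) * stableDensity α (t - s) (z 0 - y) /
        stableDensity α t (x - y) := by
  simp [stableBridgeDensity, Fin.prod_univ_succ, Fin.snoc]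

theorem stableBridgeDensity_two (x y : EuclideanSpace ℝ (Fin d)) (s r : ℝ)
    (z : Fin 2 → EuclideanSpace ℝ (Fin d)) :
    stableBridgeDensity α t x y ![s, r] z =
      stableDensity α s (x - z 0) * (stableDensity α (r - s) (z 0 - z 1) *
        stableDensity α (t - r) (z 1 - y)) / stableDensity α t (x - y) := by
  have hτ : (Fin.cons 0 (Fin.snoc ![s, r] t : Fin 3 → ℝ) : Fin 4 → ℝ) = ![0, s, r, t] := by
    funext i
    fin_cases i <;> rfl
  have hζ : (Fin.cons x (Fin.snoc z y : Fin 3 → EuclideanSpace ℝ (Fin d)) :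
      Fin 4 → EuclideanSpace ℝ (Fin d)) = ![x, z 0, z 1, y] := by
    funext i
    fin_cases i <;> rfl
  simp only [stableBridgeDensity, hτ, hζ]
  simp [Fin.prod_univ_succ]

theorem measurable_ofReal_stableDensity_comp {β : Type*} [MeasurableSpace β] {s : β → ℝ}
    {z : β → EuclideanSpace ℝ (Fin d)} (hs : Measurable s) (hz : Measurable z) :
    Measurable fun q => ENNReal.ofReal (stableDensity α (s q) (z q)) :=
  (measurable_stableDensity_comp hs hz).ennreal_ofReal

/-- Expectation of a function of one marginal of the bridge, multiplied by the density of the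
endpoint. -/
theorem IsStableBridge.ofReal_mul_lintegral_one {x y : EuclideanSpace ℝ (Fin d)} {P : Measure Ω}
    (h : IsStableBridge α t x y X P)
    (hpos : ∀ u : ℝ, 0 < u → ∀ z : EuclideanSpace ℝ (Fin d), 0 < stableDensity α u z)
    {s : ℝ} (hs0 : 0 < s) (hst : s < t) {g : EuclideanSpace ℝ (Fin d) → ℝ≥0∞}
    (hg : Measurable g) :
    ENNReal.ofReal (stableDensity α t (x - y)) * ∫⁻ ω, g (X s ω) ∂P =
      ∫⁻ z, ENNReal.ofReal (stableDensity α s (x - z)) *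
        ENNReal.ofReal (stableDensity α (t - s) (z - y)) * g z := by
  have hp := hpos t (hs0.trans hst) (x - y)
  have h1 := h.lintegral_comp (n := 1) (s := fun _ => s) (Subsingleton.strictMono _)
    (fun _ => ⟨hs0, hst⟩) (g := fun z => g (z 0)) (by fun_prop)
  rw [h1, ← lintegral_const_mul' _ _ ENNReal.ofReal_ne_top,
    ← (volume_preserving_funUnique (Fin 1) (EuclideanSpace ℝ (Fin d))).lintegral_comp]
  · refine lintegral_congr fun z => ?_
    have hz : MeasurableEquiv.funUnique (Fin 1) (EuclideanSpace ℝ (Fin d)) z = z 0 := rfl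
    rw [hz, stableBridgeDensity_one, ← mul_assoc, ← ENNReal.ofReal_mul hp.le,
      mul_div_cancel₀ _ hp.ne', ENNReal.ofReal_mul (hpos s hs0 _).le]
  · exact ((measurable_ofReal_stableDensity_comp measurable_const
      (measurable_const.sub measurable_id)).mul (measurable_ofReal_stableDensity_comp
        measurable_const (measurable_id.sub measurable_const))).mul hg

/-- Expectation of a function of two marginals of the bridge, multiplied by the density of the
endpoint. -/
theorem IsStableBridge.ofReal_mul_lintegral_two {x y : EuclideanSpace ℝ (Fin d)} {P : Measure Ω}
    (h : IsStableBridge α t x y X P)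
    (hpos : ∀ u : ℝ, 0 < u → ∀ z : EuclideanSpace ℝ (Fin d), 0 < stableDensity α u z)
    {s r : ℝ} (hs0 : 0 < s) (hsr : s < r) (hrt : r < t)
    {g : EuclideanSpace ℝ (Fin d) × EuclideanSpace ℝ (Fin d) → ℝ≥0∞} (hg : Measurable g) :
    ENNReal.ofReal (stableDensity α t (x - y)) * ∫⁻ ω, g (X s ω, X r ω) ∂P =
      ∫⁻ z : EuclideanSpace ℝ (Fin d) × EuclideanSpace ℝ (Fin d),
        ENNReal.ofReal (stableDensity α s (x - z.1)) *
        ENNReal.ofReal (stableDensity α (t - r) (z.2 - y)) *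
        (ENNReal.ofReal (stableDensity α (r - s) (z.1 - z.2)) * g z) := by
  have hp := hpos t (hs0.trans (hsr.trans hrt)) (x - y)
  have hmono : StrictMono ![s, r] := by
    intro i j hij
    fin_cases i <;> fin_cases j <;> simp_all
  have h1 := h.lintegral_comp (n := 2) (s := ![s, r]) hmono
    (fun i => by fin_cases i <;> simp <;> constructor <;> linarith)
    (g := fun z => g (z 0, z 1)) (by fun_prop)
  simp only [Matrix.cons_val_zero, Matrix.cons_val_one] at h1
  rw [h1, ← lintegral_const_mul' _ _ ENNReal.ofReal_ne_top,
    ← (volume_preserving_finTwoArrow (EuclideanSpace ℝ (Fin d))).lintegral_comp]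
  · refine lintegral_congr fun z => ?_
    have hz : MeasurableEquiv.finTwoArrow z = (z 0, z 1) := rfl
    rw [hz, stableBridgeDensity_two, ← mul_assoc, ← ENNReal.ofReal_mul hp.le,
      mul_div_cancel₀ _ hp.ne', ENNReal.ofReal_mul (hpos s hs0 _).le,
      ENNReal.ofReal_mul (hpos (r - s) (sub_pos.2 hsr) _).le]
    ring
  · exact ((measurable_ofReal_stableDensity_comp measurable_const
      (measurable_const.sub measurable_fst)).mul (measurable_ofReal_stableDensity_comp
        measurable_const (measurable_snd.sub measurable_const))).mul
        ((measurable_ofReal_stableDensity_comp measurable_const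
          (measurable_fst.sub measurable_snd)).mul hg)

/-- Integrating out the two endpoints of a path of the stable process leaves the weight of its
inner part, since each transition density has mass one. -/
theorem lintegral_lintegral_endpoints (hd : 1 ≤ d) (hα : 0 < α)
    (hpos : ∀ u : ℝ, 0 < u → ∀ z : EuclideanSpace ℝ (Fin d), 0 < stableDensity α u z)
    {Θ : Type*} [MeasurableSpace Θ] {ν : Measure Θ} [SFinite ν] {u v : Θ → ℝ}
    {a b : Θ → EuclideanSpace ℝ (Fin d)} {c : Θ → ℝ≥0∞} (hu : Measurable u) (hv : Measurable v)
    (ha : Measurable a) (hb : Measurable b) (hc : Measurable c) (huv : ∀ᵐ θ ∂ν, 0 < u θ ∧ 0 < v θ) :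
    ∫⁻ q : EuclideanSpace ℝ (Fin d) × EuclideanSpace ℝ (Fin d), ∫⁻ θ,
      ENNReal.ofReal (stableDensity α (u θ) (q.1 - a θ)) *
      ENNReal.ofReal (stableDensity α (v θ) (b θ - q.2)) * c θ ∂ν = ∫⁻ θ, c θ ∂ν := by
  have hm1 : Measurable fun p : (EuclideanSpace ℝ (Fin d) × EuclideanSpace ℝ (Fin d)) × Θ =>
      ENNReal.ofReal (stableDensity α (u p.2) (p.1.1 - a p.2)) :=
    measurable_ofReal_stableDensity_comp (hu.comp measurable_snd)
      (measurable_fst.fst.sub (ha.comp measurable_snd))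
  have hm2 : Measurable fun p : (EuclideanSpace ℝ (Fin d) × EuclideanSpace ℝ (Fin d)) × Θ =>
      ENNReal.ofReal (stableDensity α (v p.2) (b p.2 - p.1.2)) :=
    measurable_ofReal_stableDensity_comp (hv.comp measurable_snd)
      ((hb.comp measurable_snd).sub measurable_fst.snd)
  rw [lintegral_lintegral_swap ((hm1.mul hm2).mul (hc.comp measurable_snd)).aemeasurable]
  refine lintegral_congr_ae ?_
  filter_upwards [huv] with θ ⟨hu0, hv0⟩
  have hk1 : Measurable fun x : EuclideanSpace ℝ (Fin d) =>
      ENNReal.ofReal (stableDensity α (u θ) (x - a θ)) :=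
    measurable_ofReal_stableDensity_comp measurable_const (measurable_id.sub measurable_const)
  have hk2 : Measurable fun y : EuclideanSpace ℝ (Fin d) =>
      ENNReal.ofReal (stableDensity α (v θ) (b θ - y)) :=
    measurable_ofReal_stableDensity_comp measurable_const (measurable_const.sub measurable_id)
  have hkk : Measurable fun q : EuclideanSpace ℝ (Fin d) × EuclideanSpace ℝ (Fin d) =>
      ENNReal.ofReal (stableDensity α (u θ) (q.1 - a θ)) *
      ENNReal.ofReal (stableDensity α (v θ) (b θ - q.2)) :=
    (hk1.comp measurable_fst).mul (hk2.comp measurable_snd)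
  rw [lintegral_mul_const _ hkk, Measure.volume_eq_prod,
    lintegral_prod_mul hk1.aemeasurable hk2.aemeasurable,
    lintegral_sub_right_eq_self (fun x => ENNReal.ofReal (stableDensity α (u θ) x)) (a θ),
    lintegral_sub_left_eq_self (fun x => ENNReal.ofReal (stableDensity α (v θ) x)) (b θ),
    lintegral_stableDensity hd hα hu0 fun z => (hpos _ hu0 z).le,
    lintegral_stableDensity hd hα hv0 fun z => (hpos _ hv0 z).le, one_mul, one_mul]

/-- Integrating the occupation functional `∫_0^t g(X_s) ds` of the bridge over all endpoints
gives `t ∫ g`. -/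
theorem lintegral_bridge_occupation (hd : 1 ≤ d) (hα : 0 < α)
    (hpos : ∀ u : ℝ, 0 < u → ∀ z : EuclideanSpace ℝ (Fin d), 0 < stableDensity α u z)
    {P : EuclideanSpace ℝ (Fin d) → EuclideanSpace ℝ (Fin d) → Measure Ω}
    (hP : ∀ x y, IsStableBridge α t x y X (P x y)) {g : EuclideanSpace ℝ (Fin d) → ℝ≥0∞}
    (hg : Measurable g) :
    ∫⁻ q : EuclideanSpace ℝ (Fin d) × EuclideanSpace ℝ (Fin d),
      ENNReal.ofReal (stableDensity α t (q.1 - q.2)) *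
        ∫⁻ ω, (∫⁻ s in Set.Ioo 0 t, g (X s ω)) ∂(P q.1 q.2) =
      ENNReal.ofReal t * ∫⁻ z, g z := by
  set ν : Measure ℝ := volume.restrict (Set.Ioo 0 t) with hν
  have hmem : ∀ᵐ s ∂ν, s ∈ Set.Ioo 0 t := ae_restrict_mem measurableSet_Ioo
  have hmem' : ∀ᵐ θ ∂(ν.prod (volume : Measure (EuclideanSpace ℝ (Fin d)))),
      θ.1 ∈ Set.Ioo 0 t := Measure.quasiMeasurePreserving_fst.ae hmem
  have hone : ∀ q : EuclideanSpace ℝ (Fin d) × EuclideanSpace ℝ (Fin d),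
      ENNReal.ofReal (stableDensity α t (q.1 - q.2)) *
        ∫⁻ ω, ∫⁻ s, g (X s ω) ∂ν ∂(P q.1 q.2) =
      ∫⁻ θ : ℝ × EuclideanSpace ℝ (Fin d), ENNReal.ofReal (stableDensity α θ.1 (q.1 - θ.2)) *
        ENNReal.ofReal (stableDensity α (t - θ.1) (θ.2 - q.2)) * g θ.2 ∂(ν.prod volume) := by
    intro q
    have hq := hP q.1 q.2
    have := hq.isProbabilityMeasure
    have hX : Measurable fun p : Ω × ℝ => g (X p.2 p.1) :=
      hg.comp (hq.measurable.comp measurable_swap)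
    rw [lintegral_lintegral_swap hX.aemeasurable,
      ← lintegral_const_mul' _ _ ENNReal.ofReal_ne_top, lintegral_prod]
    · refine lintegral_congr_ae ?_
      filter_upwards [hmem] with s hs
      exact hq.ofReal_mul_lintegral_one hpos hs.1 hs.2 hg
    · exact (((measurable_ofReal_stableDensity_comp measurable_fst
        (measurable_const.sub measurable_snd)).mul (measurable_ofReal_stableDensity_comp
          (measurable_const.sub measurable_fst) (measurable_snd.sub measurable_const))).mul
          (hg.comp measurable_snd)).aemeasurable
  simp_rw [hone]
  rw [lintegral_lintegral_endpoints (Θ := ℝ × EuclideanSpace ℝ (Fin d)) (ν := ν.prod volume)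
    hd hα hpos (u := fun θ => θ.1) (v := fun θ => t - θ.1)
    (a := fun θ => θ.2) (b := fun θ => θ.2) (c := fun θ => g θ.2) measurable_fst
    (measurable_const.sub measurable_fst) measurable_snd measurable_snd (hg.comp measurable_snd)
    (by filter_upwards [hmem'] with θ hθ using ⟨hθ.1, sub_pos.2 hθ.2⟩),
    lintegral_prod (fun θ : ℝ × EuclideanSpace ℝ (Fin d) => g θ.2)
      (hg.comp measurable_snd).aemeasurable]
  simp [hν, mul_comm]

theorem ae_ne_prod_restrict_Ioo (t : ℝ) :
    ∀ᵐ s ∂((volume.restrict (Set.Ioo 0 t)).prod (volume.restrict (Set.Ioo 0 t))), s.1 ≠ s.2 := by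
  have hdiag : ((volume.restrict (Set.Ioo 0 t)).prod (volume.restrict (Set.Ioo 0 t)))
      (Set.diagonal ℝ) = 0 := by
    rw [Measure.measure_prod_null measurableSet_diagonal]
    refine Eventually.of_forall fun s => ?_
    have : Prod.mk s ⁻¹' Set.diagonal ℝ = {s} := by
      ext r
      simp [eq_comm]
    beta_reduce
    rw [this]
    simp
  exact measure_mono_null (fun s hs => by simpa using hs) hdiag

/-- Integrating a symmetric two-point functional of the bridge over all endpoints leaves the
joint weight of the two points, at the time difference between them. -/
theorem lintegral_bridge_two_point (hd : 1 ≤ d) (hα : 0 < α)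
    (hpos : ∀ u : ℝ, 0 < u → ∀ z : EuclideanSpace ℝ (Fin d), 0 < stableDensity α u z)
    {P : EuclideanSpace ℝ (Fin d) → EuclideanSpace ℝ (Fin d) → Measure Ω}
    (hP : ∀ x y, IsStableBridge α t x y X (P x y))
    {g : EuclideanSpace ℝ (Fin d) × EuclideanSpace ℝ (Fin d) → ℝ≥0∞} (hg : Measurable g)
    (hsymm : ∀ z w, g (z, w) = g (w, z)) :
    ∫⁻ q : EuclideanSpace ℝ (Fin d) × EuclideanSpace ℝ (Fin d),
      ENNReal.ofReal (stableDensity α t (q.1 - q.2)) *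
        ∫⁻ ω, ∫⁻ s, g (X s.1 ω, X s.2 ω)
          ∂((volume.restrict (Set.Ioo 0 t)).prod (volume.restrict (Set.Ioo 0 t))) ∂(P q.1 q.2) =
      ∫⁻ s, (∫⁻ z : EuclideanSpace ℝ (Fin d) × EuclideanSpace ℝ (Fin d),
        ENNReal.ofReal (stableDensity α |s.1 - s.2| (z.1 - z.2)) * g z)
          ∂((volume.restrict (Set.Ioo 0 t)).prod (volume.restrict (Set.Ioo 0 t))) := by
  set ν : Measure ℝ := volume.restrict (Set.Ioo 0 t) with hν
  have hmem : ∀ᵐ s ∂ν, s ∈ Set.Ioo 0 t := ae_restrict_mem measurableSet_Ioo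
  have hmem2 : ∀ᵐ s ∂(ν.prod ν), (s.1 ∈ Set.Ioo 0 t ∧ s.2 ∈ Set.Ioo 0 t) ∧ s.1 ≠ s.2 := by
    refine ((Measure.quasiMeasurePreserving_fst.ae hmem).and
      (Measure.quasiMeasurePreserving_snd.ae hmem)).and (ae_ne_prod_restrict_Ioo t)
  have hmem' : ∀ᵐ θ ∂((ν.prod ν).prod
      (volume : Measure (EuclideanSpace ℝ (Fin d) × EuclideanSpace ℝ (Fin d)))),
      (θ.1.1 ∈ Set.Ioo 0 t ∧ θ.1.2 ∈ Set.Ioo 0 t) ∧ θ.1.1 ≠ θ.1.2 :=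
    Measure.quasiMeasurePreserving_fst.ae hmem2
  have hu : Measurable fun θ : (ℝ × ℝ) × EuclideanSpace ℝ (Fin d) × EuclideanSpace ℝ (Fin d) =>
      min θ.1.1 θ.1.2 := measurable_fst.fst.min measurable_fst.snd
  have hv : Measurable fun θ : (ℝ × ℝ) × EuclideanSpace ℝ (Fin d) × EuclideanSpace ℝ (Fin d) =>
      t - max θ.1.1 θ.1.2 := measurable_const.sub (measurable_fst.fst.max measurable_fst.snd)
  have hc : Measurable fun θ : (ℝ × ℝ) × EuclideanSpace ℝ (Fin d) × EuclideanSpace ℝ (Fin d) =>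
      ENNReal.ofReal (stableDensity α |θ.1.1 - θ.1.2| (θ.2.1 - θ.2.2)) * g θ.2 :=
    (measurable_ofReal_stableDensity_comp (measurable_fst.fst.sub measurable_fst.snd).abs
      (measurable_snd.fst.sub measurable_snd.snd)).mul (hg.comp measurable_snd)
  have hone : ∀ q : EuclideanSpace ℝ (Fin d) × EuclideanSpace ℝ (Fin d),
      ENNReal.ofReal (stableDensity α t (q.1 - q.2)) *
        ∫⁻ ω, ∫⁻ s, g (X s.1 ω, X s.2 ω) ∂(ν.prod ν) ∂(P q.1 q.2) =
      ∫⁻ θ : (ℝ × ℝ) × EuclideanSpace ℝ (Fin d) × EuclideanSpace ℝ (Fin d),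
        ENNReal.ofReal (stableDensity α (min θ.1.1 θ.1.2) (q.1 - θ.2.1)) *
        ENNReal.ofReal (stableDensity α (t - max θ.1.1 θ.1.2) (θ.2.2 - q.2)) *
        (ENNReal.ofReal (stableDensity α |θ.1.1 - θ.1.2| (θ.2.1 - θ.2.2)) * g θ.2)
          ∂((ν.prod ν).prod volume) := by
    intro q
    have hq := hP q.1 q.2
    have := hq.isProbabilityMeasure
    have hX : Measurable fun p : Ω × (ℝ × ℝ) => g (X p.2.1 p.1, X p.2.2 p.1) := by
      have h1 : Measurable fun p : Ω × (ℝ × ℝ) => (p.2.1, p.1) := by fun_prop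
      have h2 : Measurable fun p : Ω × (ℝ × ℝ) => (p.2.2, p.1) := by fun_prop
      exact hg.comp ((hq.measurable.comp h1).prodMk (hq.measurable.comp h2))
    rw [lintegral_lintegral_swap hX.aemeasurable,
      ← lintegral_const_mul' _ _ ENNReal.ofReal_ne_top,
      lintegral_prod (μ := ν.prod ν)]
    · refine lintegral_congr_ae ?_
      filter_upwards [hmem2] with s ⟨⟨hs1, hs2⟩, hne⟩
      rcases lt_or_gt_of_ne hne with hlt | hlt
      · rw [hq.ofReal_mul_lintegral_two hpos hs1.1 hlt hs2.2 hg]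
        simp only [min_eq_left hlt.le, max_eq_right hlt.le]
        rw [abs_sub_comm, abs_of_pos (sub_pos.2 hlt)]
      · simp_rw [hsymm (X s.1 _) (X s.2 _)]
        rw [hq.ofReal_mul_lintegral_two hpos hs2.1 hlt hs1.2 hg]
        simp only [min_eq_right hlt.le, max_eq_left hlt.le]
        rw [abs_of_pos (sub_pos.2 hlt)]
    · exact (((measurable_ofReal_stableDensity_comp hu
        (measurable_const.sub measurable_snd.fst)).mul (measurable_ofReal_stableDensity_comp
          hv (measurable_snd.snd.sub measurable_const))).mul hc).aemeasurable
  simp_rw [hone]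
  rw [lintegral_lintegral_endpoints hd hα hpos hu hv measurable_snd.fst measurable_snd.snd hc
    (by
      filter_upwards [hmem'] with θ hθ
      exact ⟨lt_min hθ.1.1.1 hθ.1.2.1, sub_pos.2 (max_lt hθ.1.1.2 hθ.1.2.2)⟩),
    lintegral_prod _ hc.aemeasurable]

end LIntegral

/-! ### First order term -/

section Moments

variable {d : ℕ} {α t γ : ℝ}

theorem lintegral_stableDensity_mul_norm_rpow_le (hd : 1 ≤ d) (hα : 0 < α) (hγ : 0 < γ)
    (hγα : γ < α) {u : ℝ} (hu : 0 < u)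
    (h : ∀ z : EuclideanSpace ℝ (Fin d), 0 ≤ stableDensity α u z) :
    ∫⁻ z : EuclideanSpace ℝ (Fin d),
      ENNReal.ofReal (stableDensity α u z) * ENNReal.ofReal (‖z‖ ^ γ) ≤
        ENNReal.ofReal (stableMomentConst d α γ * u ^ (γ / α)) := by
  have h1 := lintegral_norm_rpow_stableMeasure_le hd hα hu hγ hγα h
  have hm : Measurable fun z : EuclideanSpace ℝ (Fin d) => ENNReal.ofReal (stableDensity α u z) :=
    measurable_ofReal_stableDensity_comp measurable_const measurable_id
  rwa [stableMeasure, lintegral_withDensity_eq_lintegral_mul _ hm (by fun_prop)] at h1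

/-- The weight of pairs of points of the stable process at time distance `u`, where a pair counts
with its Hölder modulus `|z-w|^γ` and the weight `v` of either point. -/
theorem lintegral_two_point_holder_le (hd : 1 ≤ d) (hα : 0 < α) (hγ : 0 < γ)
    (hγα : γ < α) {u : ℝ} (hu : 0 < u)
    (h : ∀ z : EuclideanSpace ℝ (Fin d), 0 ≤ stableDensity α u z)
    {v : EuclideanSpace ℝ (Fin d) → ℝ≥0∞} (hv : Measurable v) :
    ∫⁻ z : EuclideanSpace ℝ (Fin d) × EuclideanSpace ℝ (Fin d),
      ENNReal.ofReal (stableDensity α u (z.1 - z.2)) *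
        ((v z.1 + v z.2) * ENNReal.ofReal (‖z.1 - z.2‖ ^ γ)) ≤
      2 * (∫⁻ z, v z) * ENNReal.ofReal (stableMomentConst d α γ * u ^ (γ / α)) := by
  set w : EuclideanSpace ℝ (Fin d) → ℝ≥0∞ := fun z =>
    ENNReal.ofReal (stableDensity α u z) * ENNReal.ofReal (‖z‖ ^ γ) with hw
  have hwm : Measurable w :=
    (measurable_ofReal_stableDensity_comp measurable_const measurable_id).mul (by fun_prop)
  have hm1 : Measurable fun z : EuclideanSpace ℝ (Fin d) × EuclideanSpace ℝ (Fin d) =>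
    v z.1 * w (z.1 - z.2) := by fun_prop
  have hm2 : Measurable fun z : EuclideanSpace ℝ (Fin d) × EuclideanSpace ℝ (Fin d) =>
    v z.2 * w (z.1 - z.2) := by fun_prop
  calc _ = ∫⁻ z : EuclideanSpace ℝ (Fin d) × EuclideanSpace ℝ (Fin d),
        (v z.1 * w (z.1 - z.2) + v z.2 * w (z.1 - z.2)) := by
        refine lintegral_congr fun z => ?_
        rw [hw]
        ring
    _ = (∫⁻ z, v z) * (∫⁻ z, w z) + (∫⁻ z, v z) * ∫⁻ z, w z := by
        rw [lintegral_add_left hm1, Measure.volume_eq_prod, lintegral_prod _ hm1.aemeasurable,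
          lintegral_prod_symm _ hm2.aemeasurable, ← lintegral_mul_const _ hv]
        congr 1
        · refine lintegral_congr fun z => ?_
          have hm : Measurable fun y => w (z - y) := by fun_prop
          dsimp only
          rw [lintegral_const_mul _ hm, lintegral_sub_left_eq_self w z]
        · refine lintegral_congr fun z => ?_
          have hm : Measurable fun y => w (y - z) := by fun_prop
          dsimp only
          rw [lintegral_const_mul _ hm, lintegral_sub_right_eq_self w z]
    _ = 2 * (∫⁻ z, v z) * ∫⁻ z, w z := by ring
    _ ≤ _ := mul_le_mul_right (lintegral_stableDensity_mul_norm_rpow_le hd hα hγ hγα hu h) _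

theorem abs_exp_neg_sub_taylor_le (a : ℝ) :
    |Real.exp (-a) - 1 + a - a ^ 2 / 2| ≤ |a| ^ 3 * Real.exp |a| := by
  have h := Complex.norm_exp_sub_sum_le_norm_mul_exp (-a : ℂ) 3
  have h2 : Complex.exp (-a : ℂ) - ∑ m ∈ Finset.range 3, (-a : ℂ) ^ m / m.factorial =
      ((Real.exp (-a) - 1 + a - a ^ 2 / 2 : ℝ) : ℂ) := by
    simp [Finset.sum_range_succ, Nat.factorial]
    ring
  rw [h2, Complex.norm_real, norm_neg, Complex.norm_real] at h
  exact h

theorem abs_integral_le_of_lintegral_enorm_le {β : Type*} [MeasurableSpace β] {μ : Measure β}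
    {f : β → ℝ} {c : ℝ} (hc : 0 ≤ c) (h : ∫⁻ x, ‖f x‖ₑ ∂μ ≤ ENNReal.ofReal c) :
    |∫ x, f x ∂μ| ≤ c := by
  have h1 := (enorm_integral_le_lintegral_enorm f).trans h
  rw [← ofReal_norm] at h1
  exact (ENNReal.ofReal_le_ofReal_iff hc).1 h1

/-- The difference `(∫ f)² - t ∫ f²` is the double integral of `f(s) (f(r) - f(s))`. The bound is
stated with a weight symmetric in `s` and `r`. -/
theorem enorm_sq_sub_le {f : ℝ → ℝ} (ht : 0 < t) (hf : Measurable f) {B : ℝ}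
    (hB : ∀ s, |f s| ≤ B) {v : ℝ × ℝ → ℝ≥0∞} (hv : ∀ s r, ‖f s - f r‖ₑ ≤ v (s, r)) :
    ‖(∫ s in Set.Ioo 0 t, f s) ^ 2 - t * ∫ s in Set.Ioo 0 t, f s ^ 2‖ₑ ≤
      ∫⁻ s, (‖f s.1‖ₑ + ‖f s.2‖ₑ) * v s
        ∂((volume.restrict (Set.Ioo 0 t)).prod (volume.restrict (Set.Ioo 0 t))) := by
  set ν : Measure ℝ := volume.restrict (Set.Ioo 0 t) with hν
  have hB0 : 0 ≤ B := (abs_nonneg _).trans (hB 0)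
  have h1 : (∫ s, f s ∂ν) ^ 2 = ∫ s, f s.1 * f s.2 ∂(ν.prod ν) := by
    rw [integral_prod_mul, sq]
  have h2 : t * ∫ s, f s ^ 2 ∂ν = ∫ s : ℝ × ℝ, f s.1 ^ 2 * 1 ∂(ν.prod ν) := by
    rw [integral_prod_mul (fun s => f s ^ 2) (fun _ => (1 : ℝ))]
    simp [hν, Measure.real, ht.le, mul_comm]
  have hi1 : Integrable (fun s : ℝ × ℝ => f s.1 * f s.2) (ν.prod ν) :=
    Integrable.of_bound (C := B * B) (by fun_prop) (Eventually.of_forall fun s => by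
      rw [norm_mul]
      exact mul_le_mul (hB _) (hB _) (norm_nonneg _) hB0)
  have hi2 : Integrable (fun s : ℝ × ℝ => f s.1 ^ 2 * 1) (ν.prod ν) :=
    Integrable.of_bound (C := B ^ 2)
      (Measurable.aestronglyMeasurable (by fun_prop)) (Eventually.of_forall fun s => by
      rw [mul_one, norm_pow]
      exact pow_le_pow_left₀ (norm_nonneg _) (hB _) 2)
  rw [h1, h2, ← integral_sub hi1 hi2]
  refine (enorm_integral_le_lintegral_enorm _).trans (lintegral_mono fun s => ?_)
  have h3 : f s.1 * f s.2 - f s.1 ^ 2 * 1 = -(f s.1 * (f s.1 - f s.2)) := by ring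
  beta_reduce
  rw [h3, enorm_neg, enorm_mul]
  exact mul_le_mul' le_self_add (hv _ _)

end Moments

section Expansion

variable {d : ℕ} {α t γ : ℝ} {Ω : Type*} [MeasurableSpace Ω]
  {X : ℝ → Ω → EuclideanSpace ℝ (Fin d)}
  {P : EuclideanSpace ℝ (Fin d) → EuclideanSpace ℝ (Fin d) → Measure Ω}

/-- The expectation of `φ` under the bridge with endpoints `q`, multiplied by the density
`p_t(q.1 - q.2)`. -/
noncomputable def bridgeMean (α t : ℝ)
    (P : EuclideanSpace ℝ (Fin d) → EuclideanSpace ℝ (Fin d) → Measure Ω) (φ : Ω → ℝ)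
    (q : EuclideanSpace ℝ (Fin d) × EuclideanSpace ℝ (Fin d)) : ℝ :=
  stableDensity α t (q.1 - q.2) * ∫ ω, φ ω ∂(P q.1 q.2)

theorem measurable_bridgeMean {φ : Ω → ℝ} (h : Measurable fun q : EuclideanSpace ℝ (Fin d) ×
    EuclideanSpace ℝ (Fin d) => ∫ ω, φ ω ∂(P q.1 q.2)) : Measurable (bridgeMean α t P φ) :=
  (measurable_stableDensity_comp measurable_const (measurable_fst.sub measurable_snd)).mul h

theorem enorm_bridgeMean_le (hpos : ∀ z : EuclideanSpace ℝ (Fin d), 0 < stableDensity α t z)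
    (φ : Ω → ℝ) (q : EuclideanSpace ℝ (Fin d) × EuclideanSpace ℝ (Fin d)) :
    ‖bridgeMean α t P φ q‖ₑ ≤
      ENNReal.ofReal (stableDensity α t (q.1 - q.2)) * ∫⁻ ω, ‖φ ω‖ₑ ∂(P q.1 q.2) := by
  rw [bridgeMean, enorm_mul, Real.enorm_of_nonneg (hpos _).le]
  exact mul_le_mul_right (enorm_integral_le_lintegral_enorm _) _

theorem IsStableBridge.integrable_path {x y : EuclideanSpace ℝ (Fin d)} {P : Measure Ω}
    (h : IsStableBridge α t x y X P) {f : EuclideanSpace ℝ (Fin d) → ℝ} (hf : Measurable f)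
    {B : ℝ} (hB : ∀ x, |f x| ≤ B) (ω : Ω) : IntegrableOn (fun s => f (X s ω)) (Set.Ioo 0 t) :=
  Integrable.of_bound (C := B) (hf.comp (h.measurable_path ω)).aestronglyMeasurable
    (Eventually.of_forall fun _ => hB _)

theorem IsStableBridge.integrable_occupation {x y : EuclideanSpace ℝ (Fin d)} {P : Measure Ω}
    (h : IsStableBridge α t x y X P) (ht : 0 < t) {f : EuclideanSpace ℝ (Fin d) → ℝ}
    (hf : Measurable f) {B : ℝ} (hB : ∀ x, |f x| ≤ B) :
    Integrable (fun ω => ∫ s in Set.Ioo 0 t, f (X s ω)) P := by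
  have := h.isProbabilityMeasure
  exact Integrable.of_bound (C := t * B) (h.measurable_setIntegral_path hf).aestronglyMeasurable
    (Eventually.of_forall fun ω => abs_setIntegral_comp_le ht hB fun s => X s ω)

theorem lintegral_enorm_bridgeMean_occupation_le (hd : 1 ≤ d) (hα : 0 < α) (ht : 0 < t)
    (hpos : ∀ u : ℝ, 0 < u → ∀ z : EuclideanSpace ℝ (Fin d), 0 < stableDensity α u z)
    (hP : ∀ x y, IsStableBridge α t x y X (P x y)) {f : EuclideanSpace ℝ (Fin d) → ℝ}
    (hf : Measurable f) {φ : Ω → ℝ} {c : ℝ≥0∞} (hc : c ≠ ∞)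
    (hφ : ∀ ω, ‖φ ω‖ₑ ≤ c * ∫⁻ s in Set.Ioo 0 t, ‖f (X s ω)‖ₑ) :
    ∫⁻ q, ‖bridgeMean α t P φ q‖ₑ ≤ c * (ENNReal.ofReal t * ∫⁻ z, ‖f z‖ₑ) := by
  rw [← lintegral_bridge_occupation hd hα hpos hP hf.enorm, ← lintegral_const_mul' _ _ hc]
  refine lintegral_mono fun q => (enorm_bridgeMean_le (hpos t ht) φ q).trans ?_
  rw [mul_left_comm, ← lintegral_const_mul' _ _ hc]
  exact mul_le_mul_right (lintegral_mono hφ) _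

theorem measurable_bridgeMean_occupation
    (hP : ∀ x y, IsStableBridge α t x y X (P x y)) {f : EuclideanSpace ℝ (Fin d) → ℝ}
    (hf : Measurable f) {B : ℝ} (hB : ∀ x, |f x| ≤ B) :
    Measurable (bridgeMean α t P fun ω => ∫ s in Set.Ioo 0 t, f (X s ω)) := by
  refine measurable_bridgeMean ?_
  simpa only [pow_one] using measurable_integral_bridge_pow hP hf hB 1

theorem integrable_bridgeMean_occupation (hd : 1 ≤ d) (hα : 0 < α) (ht : 0 < t)
    (hpos : ∀ u : ℝ, 0 < u → ∀ z : EuclideanSpace ℝ (Fin d), 0 < stableDensity α u z)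
    (hP : ∀ x y, IsStableBridge α t x y X (P x y)) {f : EuclideanSpace ℝ (Fin d) → ℝ}
    (hf : Measurable f) {B : ℝ} (hB : ∀ x, |f x| ≤ B) (hfi : Integrable f) :
    Integrable (bridgeMean α t P fun ω => ∫ s in Set.Ioo 0 t, f (X s ω)) := by
  refine ⟨(measurable_bridgeMean_occupation hP hf hB).aestronglyMeasurable, ?_⟩
  refine (lintegral_enorm_bridgeMean_occupation_le hd hα ht hpos hP hf (c := 1)
    ENNReal.one_ne_top (fun ω => ?_)).trans_lt ?_
  · rw [one_mul]
    exact enorm_integral_le_lintegral_enorm _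
  · rw [one_mul]
    exact ENNReal.mul_lt_top ENNReal.ofReal_lt_top hfi.2

theorem integral_bridgeMean_occupation_of_nonneg (hd : 1 ≤ d) (hα : 0 < α) (ht : 0 < t)
    (hpos : ∀ u : ℝ, 0 < u → ∀ z : EuclideanSpace ℝ (Fin d), 0 < stableDensity α u z)
    (hP : ∀ x y, IsStableBridge α t x y X (P x y)) {f : EuclideanSpace ℝ (Fin d) → ℝ}
    (hf : Measurable f) {B : ℝ} (hB : ∀ x, |f x| ≤ B) (hf0 : ∀ x, 0 ≤ f x) :
    ∫ q, bridgeMean α t P (fun ω => ∫ s in Set.Ioo 0 t, f (X s ω)) q = t * ∫ z, f z := by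
  have hJ0 : ∀ ω, 0 ≤ ∫ s in Set.Ioo 0 t, f (X s ω) := fun ω => integral_nonneg fun _ => hf0 _
  rw [integral_eq_lintegral_of_nonneg_ae (f := bridgeMean α t P _)
    (Eventually.of_forall fun q => mul_nonneg (hpos t ht _).le (integral_nonneg hJ0))
    (measurable_bridgeMean_occupation hP hf hB).aestronglyMeasurable,
    integral_eq_lintegral_of_nonneg_ae (Eventually.of_forall hf0) hf.aestronglyMeasurable]
  have h := lintegral_bridge_occupation hd hα hpos hP hf.ennreal_ofReal
  have hq : ∀ q, ENNReal.ofReal (bridgeMean α t P (fun ω => ∫ s in Set.Ioo 0 t, f (X s ω)) q) =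
      ENNReal.ofReal (stableDensity α t (q.1 - q.2)) *
        ∫⁻ ω, (∫⁻ s in Set.Ioo 0 t, ENNReal.ofReal (f (X s ω))) ∂(P q.1 q.2) := by
    intro q
    have hb := hP q.1 q.2
    rw [bridgeMean, ENNReal.ofReal_mul (hpos t ht _).le, ofReal_integral_eq_lintegral_ofReal
      (hb.integrable_occupation ht hf hB) (Eventually.of_forall hJ0)]
    congr 1
    refine lintegral_congr fun ω => ?_
    exact ofReal_integral_eq_lintegral_ofReal (hb.integrable_path hf hB ω)
      (Eventually.of_forall fun _ => hf0 _)
  simp_rw [hq]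
  rw [h, ENNReal.toReal_mul, ENNReal.toReal_ofReal ht.le]

/-- First order term of the expansion: integrating `p_t(x-y) E[∫_0^t f(X_s) ds]` over the
endpoints gives `t ∫ f`. -/
theorem integral_bridgeMean_occupation (hd : 1 ≤ d) (hα : 0 < α) (ht : 0 < t)
    (hpos : ∀ u : ℝ, 0 < u → ∀ z : EuclideanSpace ℝ (Fin d), 0 < stableDensity α u z)
    (hP : ∀ x y, IsStableBridge α t x y X (P x y)) {f : EuclideanSpace ℝ (Fin d) → ℝ}
    (hf : Measurable f) {B : ℝ} (hB : ∀ x, |f x| ≤ B) (hfi : Integrable f) :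
    ∫ q, bridgeMean α t P (fun ω => ∫ s in Set.Ioo 0 t, f (X s ω)) q = t * ∫ z, f z := by
  have hm1 : Measurable fun x => max (f x) 0 := hf.max measurable_const
  have hm2 : Measurable fun x => max (-f x) 0 := hf.neg.max measurable_const
  have hB0 : 0 ≤ B := (abs_nonneg _).trans (hB 0)
  have hb1 : ∀ x, |max (f x) 0| ≤ B := fun x => by
    rw [abs_of_nonneg (le_max_right _ _)]
    exact max_le ((le_abs_self _).trans (hB x)) hB0
  have hb2 : ∀ x, |max (-f x) 0| ≤ B := fun x => by
    rw [abs_of_nonneg (le_max_right _ _)]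
    exact max_le ((neg_le_abs _).trans (hB x)) hB0
  have hi1 : Integrable fun x => max (f x) 0 := hfi.pos_part
  have hi2 : Integrable fun x => max (-f x) 0 := hfi.neg_part
  have hsub : ∀ x, f x = max (f x) 0 - max (-f x) 0 := fun x => by
    exact (max_zero_sub_max_neg_zero_eq_self (f x)).symm
  have hq : bridgeMean α t P (fun ω => ∫ s in Set.Ioo 0 t, f (X s ω)) = fun q =>
      bridgeMean α t P (fun ω => ∫ s in Set.Ioo 0 t, max (f (X s ω)) 0) q -
      bridgeMean α t P (fun ω => ∫ s in Set.Ioo 0 t, max (-f (X s ω)) 0) q := by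
    funext q
    have hb := hP q.1 q.2
    simp only [bridgeMean]
    rw [← mul_sub, ← integral_sub (hb.integrable_occupation ht hm1 hb1)
      (hb.integrable_occupation ht hm2 hb2)]
    congr 2 with ω
    rw [← integral_sub (hb.integrable_path hm1 hb1 ω) (hb.integrable_path hm2 hb2 ω)]
    congr 1 with s
    exact hsub _
  rw [hq, integral_sub
    (integrable_bridgeMean_occupation hd hα ht hpos hP hm1 hb1 hi1)
    (integrable_bridgeMean_occupation hd hα ht hpos hP hm2 hb2 hi2),
    integral_bridgeMean_occupation_of_nonneg hd hα ht hpos hP hm1 hb1 fun _ => le_max_right _ _,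
    integral_bridgeMean_occupation_of_nonneg hd hα ht hpos hP hm2 hb2 fun _ => le_max_right _ _,
    ← mul_sub, ← integral_sub hi1 hi2]
  congr 2 with x
  exact (hsub x).symm

end Expansion

/-! ### Second order term and remainder -/

section Main

variable {d : ℕ} {α t γ : ℝ} {Ω : Type*} [MeasurableSpace Ω]
  {X : ℝ → Ω → EuclideanSpace ℝ (Fin d)}
  {P : EuclideanSpace ℝ (Fin d) → EuclideanSpace ℝ (Fin d) → Measure Ω}

/-- Second order term of the expansion: for Hölder `V`, replacing `(∫_0^t V(X_s) ds)²` by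
`t ∫_0^t V(X_s)² ds` costs at most the order `t^{γ/α+2}`. -/
theorem lintegral_enorm_bridgeMean_sq_sub_le (hd : 1 ≤ d) (hα : 0 < α) (ht : 0 < t)
    (hγ : 0 < γ) (hγα : γ < α)
    (hpos : ∀ u : ℝ, 0 < u → ∀ z : EuclideanSpace ℝ (Fin d), 0 < stableDensity α u z)
    (hP : ∀ x y, IsStableBridge α t x y X (P x y)) {V : EuclideanSpace ℝ (Fin d) → ℝ}
    (hV : Measurable V) {B : ℝ} (hB : ∀ x, |V x| ≤ B) {M : ℝ} (hM : 0 < M)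
    (hVM : ∀ x y, |V x - V y| ≤ M * ‖x - y‖ ^ γ) :
    ∫⁻ q, ‖bridgeMean α t P (fun ω => (∫ s in Set.Ioo 0 t, V (X s ω)) ^ 2 -
        t * ∫ s in Set.Ioo 0 t, V (X s ω) ^ 2) q‖ₑ ≤
      ENNReal.ofReal M * (ENNReal.ofReal t * ENNReal.ofReal t *
        (2 * (∫⁻ z, ‖V z‖ₑ) * ENNReal.ofReal (stableMomentConst d α γ * t ^ (γ / α)))) := by
  set ν : Measure ℝ := volume.restrict (Set.Ioo 0 t) with hν
  set g : EuclideanSpace ℝ (Fin d) × EuclideanSpace ℝ (Fin d) → ℝ≥0∞ := fun z =>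
    (‖V z.1‖ₑ + ‖V z.2‖ₑ) * ENNReal.ofReal (‖z.1 - z.2‖ ^ γ) with hg
  have hgm : Measurable g := by
    have := hV.enorm
    fun_prop
  have hgs : ∀ z w, g (z, w) = g (w, z) := fun z w => by
    simp only [hg]
    rw [add_comm, norm_sub_rev]
  have hK := stableMomentConst_nonneg (d := d) hγ hγα
  calc _ ≤ ∫⁻ q : EuclideanSpace ℝ (Fin d) × EuclideanSpace ℝ (Fin d), ENNReal.ofReal M *
        (ENNReal.ofReal (stableDensity α t (q.1 - q.2)) *
          ∫⁻ ω, (∫⁻ s, g (X s.1 ω, X s.2 ω) ∂(ν.prod ν)) ∂(P q.1 q.2)) := by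
        refine lintegral_mono fun q => (enorm_bridgeMean_le (hpos t ht) _ q).trans ?_
        rw [mul_left_comm]
        refine mul_le_mul_right ?_ _
        rw [← lintegral_const_mul' _ _ ENNReal.ofReal_ne_top]
        refine lintegral_mono fun ω => ?_
        refine (enorm_sq_sub_le ht (hV.comp ((hP q.1 q.2).measurable_path ω)) (fun s => hB _)
          (v := fun s => ENNReal.ofReal M * ENNReal.ofReal (‖X s.1 ω - X s.2 ω‖ ^ γ))
          fun s r => ?_).trans ?_
        · rw [← ENNReal.ofReal_mul hM.le, ← ofReal_norm]
          exact ENNReal.ofReal_le_ofReal (hVM _ _)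
        · rw [← lintegral_const_mul' _ _ ENNReal.ofReal_ne_top]
          refine lintegral_mono fun s => le_of_eq ?_
          simp only [hg, Function.comp]
          ring
    _ = ENNReal.ofReal M * ∫⁻ s, (∫⁻ z : EuclideanSpace ℝ (Fin d) × EuclideanSpace ℝ (Fin d),
        ENNReal.ofReal (stableDensity α |s.1 - s.2| (z.1 - z.2)) * g z) ∂(ν.prod ν) := by
        rw [lintegral_const_mul' _ _ ENNReal.ofReal_ne_top,
          lintegral_bridge_two_point hd hα hpos hP hgm hgs]
    _ ≤ ENNReal.ofReal M * ∫⁻ s, 2 * (∫⁻ z, ‖V z‖ₑ) *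
        ENNReal.ofReal (stableMomentConst d α γ * t ^ (γ / α)) ∂(ν.prod ν) := by
        refine mul_le_mul_right (lintegral_mono_ae ?_) _
        have hmem : ∀ᵐ s ∂ν, s ∈ Set.Ioo 0 t := ae_restrict_mem measurableSet_Ioo
        filter_upwards [Measure.quasiMeasurePreserving_fst.ae hmem,
          Measure.quasiMeasurePreserving_snd.ae hmem, ae_ne_prod_restrict_Ioo t]
          with s hs1 hs2 hne
        have hu : 0 < |s.1 - s.2| := abs_pos.2 (sub_ne_zero.2 hne)
        have hut : |s.1 - s.2| ≤ t := abs_le.2 ⟨by linarith [hs1.1, hs2.2], by linarith [hs1.2, hs2.1]⟩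
        refine (lintegral_two_point_holder_le hd hα hγ hγα hu (fun z => (hpos _ hu z).le)
          hV.enorm).trans ?_
        gcongr
    _ = _ := by
        rw [lintegral_const]
        have : (ν.prod ν) Set.univ = ENNReal.ofReal t * ENNReal.ofReal t := by
          rw [← Set.univ_prod_univ, Measure.prod_prod]
          simp [hν]
        rw [this]
        ring

/-- The quantitative expansion at a fixed time: with `A = ∫_0^t V(X_s) ds`, the Taylor polynomial
`e^{-A} ≈ 1 - A + A²/2` leaves a cubic remainder, and `A²` is compared to `t ∫_0^t V(X_s)² ds`. -/
theorem heat_content_expansion (hd : 1 ≤ d) (hα : 0 < α) (ht : 0 < t)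
    (hγ : 0 < γ) (hγα : γ < α)
    (hpos : ∀ u : ℝ, 0 < u → ∀ z : EuclideanSpace ℝ (Fin d), 0 < stableDensity α u z)
    (hP : ∀ x y, IsStableBridge α t x y X (P x y)) {V : EuclideanSpace ℝ (Fin d) → ℝ}
    (hV : Measurable V) (hVi : Integrable V) {B : ℝ} (hB : ∀ x, |V x| ≤ B) {M : ℝ} (hM : 0 < M)
    (hVM : ∀ x y, |V x - V y| ≤ M * ‖x - y‖ ^ γ) :
    Integrable (bridgeMean α t P fun ω => Real.exp (-∫ s in Set.Ioo 0 t, V (X s ω)) - 1) ∧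
    |(∫ q, bridgeMean α t P (fun ω => Real.exp (-∫ s in Set.Ioo 0 t, V (X s ω)) - 1) q) +
        t * (∫ x, V x) - t ^ 2 / 2 * (∫ x, V x ^ 2)| ≤
      (∫ x, ‖V x‖) * (B ^ 2 * Real.exp (t * B) * t ^ 3 +
        stableMomentConst d α γ * (M * t ^ (γ / α + 2))) := by
  have hB0 : 0 ≤ B := (abs_nonneg _).trans (hB 0)
  have hK := stableMomentConst_nonneg (d := d) hγ hγα
  have hV2m : Measurable fun x => V x ^ 2 := hV.pow_const 2
  have hV2b : ∀ x, |V x ^ 2| ≤ B ^ 2 := fun x => by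
    rw [abs_pow]
    exact pow_le_pow_left₀ (abs_nonneg _) (hB x) 2
  have hV2i : Integrable fun x => V x ^ 2 := by
    simp_rw [sq]
    exact hVi.mul_bdd hV.aestronglyMeasurable (Eventually.of_forall hB)
  have hN : ∫⁻ x, ‖V x‖ₑ = ENNReal.ofReal (∫ x, ‖V x‖) := by
    rw [ofReal_integral_eq_lintegral_ofReal hVi.norm (Eventually.of_forall fun _ => norm_nonneg _)]
    simp_rw [ofReal_norm]
  have hN0 : 0 ≤ ∫ x, ‖V x‖ := integral_nonneg fun _ => norm_nonneg _
  set N : ℝ := ∫ x, ‖V x‖ with hNdef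
  set A : Ω → ℝ := fun ω => ∫ s in Set.Ioo 0 t, V (X s ω) with hA
  set S : Ω → ℝ := fun ω => ∫ s in Set.Ioo 0 t, V (X s ω) ^ 2 with hS
  have hAb : ∀ ω, |A ω| ≤ t * B := fun ω => abs_setIntegral_comp_le ht hB fun s => X s ω
  set R : Ω → ℝ := fun ω => Real.exp (-A ω) - 1 + A ω - A ω ^ 2 / 2 with hR
  have hAm : ∀ q : EuclideanSpace ℝ (Fin d) × EuclideanSpace ℝ (Fin d), Measurable A :=
    fun q => (hP q.1 q.2).measurable_setIntegral_path hV
  have hAi : ∀ q : EuclideanSpace ℝ (Fin d) × EuclideanSpace ℝ (Fin d),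
      Integrable A (P q.1 q.2) := fun q => (hP q.1 q.2).integrable_occupation ht hV hB
  have hSi : ∀ q : EuclideanSpace ℝ (Fin d) × EuclideanSpace ℝ (Fin d),
      Integrable S (P q.1 q.2) := fun q => (hP q.1 q.2).integrable_occupation ht hV2m hV2b
  have hA2i : ∀ q : EuclideanSpace ℝ (Fin d) × EuclideanSpace ℝ (Fin d),
      Integrable (fun ω => A ω ^ 2) (P q.1 q.2) := fun q => by
    have := (hP q.1 q.2).isProbabilityMeasure
    refine Integrable.of_bound (C := (t * B) ^ 2) ((hAm q).pow_const 2).aestronglyMeasurable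
      (Eventually.of_forall fun ω => ?_)
    rw [norm_pow]
    exact pow_le_pow_left₀ (norm_nonneg _) (hAb ω) 2
  have hEi : ∀ q : EuclideanSpace ℝ (Fin d) × EuclideanSpace ℝ (Fin d),
      Integrable (fun ω => Real.exp (-A ω)) (P q.1 q.2) := fun q => by
    have := (hP q.1 q.2).isProbabilityMeasure
    refine Integrable.of_bound (C := Real.exp (t * B)) (hAm q).neg.exp.aestronglyMeasurable
      (Eventually.of_forall fun ω => ?_)
    rw [Real.norm_eq_abs, Real.abs_exp]
    exact Real.exp_le_exp.2 ((neg_le_abs _).trans (hAb ω))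
  -- pointwise in the endpoints, all terms of the expansion are expectations of bounded variables
  have hT : ∀ q : EuclideanSpace ℝ (Fin d) × EuclideanSpace ℝ (Fin d),
      bridgeMean α t P (fun ω => Real.exp (-A ω) - 1) q =
        stableDensity α t (q.1 - q.2) * ((∫ ω, Real.exp (-A ω) ∂(P q.1 q.2)) - 1) := fun q => by
    have := (hP q.1 q.2).isProbabilityMeasure
    rw [bridgeMean, integral_sub (hEi q) (integrable_const _)]
    simp
  have hQ : ∀ q : EuclideanSpace ℝ (Fin d) × EuclideanSpace ℝ (Fin d),
      bridgeMean α t P (fun ω => A ω ^ 2 - t * S ω) q =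
        bridgeMean α t P (fun ω => A ω ^ 2) q - t * bridgeMean α t P S q := fun q => by
    simp only [bridgeMean]
    rw [integral_sub (hA2i q) ((hSi q).const_mul t), integral_const_mul]
    ring
  have hRq : ∀ q : EuclideanSpace ℝ (Fin d) × EuclideanSpace ℝ (Fin d),
      bridgeMean α t P R q = bridgeMean α t P (fun ω => Real.exp (-A ω) - 1) q +
        bridgeMean α t P A q - bridgeMean α t P (fun ω => A ω ^ 2) q / 2 := fun q => by
    have := (hP q.1 q.2).isProbabilityMeasure
    have h1 : Integrable (fun ω => Real.exp (-A ω) - 1) (P q.1 q.2) :=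
      (hEi q).sub (integrable_const _)
    have h2 : Integrable (fun ω => Real.exp (-A ω) - 1 + A ω) (P q.1 q.2) := h1.add (hAi q)
    simp only [bridgeMean, hR]
    rw [integral_sub h2 ((hA2i q).div_const 2), integral_add h1 (hAi q),
      integral_div]
    ring
  have hTm : Measurable (bridgeMean α t P fun ω => Real.exp (-A ω) - 1) := by
    have h1 := measurable_bridgeMean (α := α) (t := t) (measurable_integral_bridge_exp ht hP hV hB)
    have h2 : Measurable fun q : EuclideanSpace ℝ (Fin d) × EuclideanSpace ℝ (Fin d) =>
        stableDensity α t (q.1 - q.2) :=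
      measurable_stableDensity_comp measurable_const (measurable_fst.sub measurable_snd)
    have h3 : (bridgeMean α t P fun ω => Real.exp (-A ω) - 1) = fun q =>
        bridgeMean α t P (fun ω => Real.exp (-A ω)) q - stableDensity α t (q.1 - q.2) := by
      funext q
      rw [hT, bridgeMean]
      ring
    rw [h3]
    exact h1.sub h2
  have hA2m : Measurable (bridgeMean α t P fun ω => A ω ^ 2) :=
    measurable_bridgeMean (measurable_integral_bridge_pow hP hV hB 2)
  have hA1 : Integrable (bridgeMean α t P A) :=
    integrable_bridgeMean_occupation hd hα ht hpos hP hV hB hVi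
  have hS1 : Integrable (bridgeMean α t P S) :=
    integrable_bridgeMean_occupation hd hα ht hpos hP hV2m hV2b hV2i
  have hAint : ∫ q, bridgeMean α t P A q = t * ∫ x, V x :=
    integral_bridgeMean_occupation hd hα ht hpos hP hV hB hVi
  have hSint : ∫ q, bridgeMean α t P S q = t * ∫ x, V x ^ 2 :=
    integral_bridgeMean_occupation hd hα ht hpos hP hV2m hV2b hV2i
  -- the comparison of `A²` with `t S`
  set c₂ : ℝ := M * (t * t * (2 * N * (stableMomentConst d α γ * t ^ (γ / α)))) with hc₂
  have hc₂0 : 0 ≤ c₂ := by positivity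
  have hQl : ∫⁻ q, ‖bridgeMean α t P (fun ω => A ω ^ 2 - t * S ω) q‖ₑ ≤ ENNReal.ofReal c₂ := by
    refine (lintegral_enorm_bridgeMean_sq_sub_le hd hα ht hγ hγα hpos hP hV hB hM hVM).trans
      (le_of_eq ?_)
    rw [hN, hc₂, ENNReal.ofReal_mul hM.le, ENNReal.ofReal_mul (p := t * t) (by positivity),
      ENNReal.ofReal_mul (p := t) ht.le, ENNReal.ofReal_mul (p := 2 * N) (by positivity),
      ENNReal.ofReal_mul (p := 2) two_pos.le, ENNReal.ofReal_ofNat]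
  have hQi : Integrable (bridgeMean α t P fun ω => A ω ^ 2 - t * S ω) := by
    refine ⟨?_, hQl.trans_lt ENNReal.ofReal_lt_top⟩
    rw [funext hQ]
    exact (hA2m.sub ((measurable_bridgeMean_occupation hP hV2m hV2b).const_mul
      t)).aestronglyMeasurable
  have hQint := abs_integral_le_of_lintegral_enorm_le hc₂0 hQl
  -- the cubic Taylor remainder
  set c₃ : ℝ := ((t * B) ^ 2 * Real.exp (t * B)) * (t * N) with hc₃
  have hc₃0 : 0 ≤ c₃ := by positivity
  have hRl : ∫⁻ q, ‖bridgeMean α t P R q‖ₑ ≤ ENNReal.ofReal c₃ := by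
    refine (lintegral_enorm_bridgeMean_occupation_le hd hα ht hpos hP hV
      (c := ENNReal.ofReal ((t * B) ^ 2 * Real.exp (t * B))) ENNReal.ofReal_ne_top
      fun ω => ?_).trans (le_of_eq ?_)
    · have h1 : |R ω| ≤ (t * B) ^ 2 * Real.exp (t * B) * |A ω| := by
        refine (abs_exp_neg_sub_taylor_le (A ω)).trans ?_
        calc |A ω| ^ 3 * Real.exp |A ω| = |A ω| ^ 2 * Real.exp |A ω| * |A ω| := by ring
          _ ≤ _ := by
            have := hAb ω
            gcongr
      calc ‖R ω‖ₑ ≤ ENNReal.ofReal ((t * B) ^ 2 * Real.exp (t * B) * |A ω|) := by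
            rw [← ofReal_norm]
            exact ENNReal.ofReal_le_ofReal h1
        _ = ENNReal.ofReal ((t * B) ^ 2 * Real.exp (t * B)) * ‖A ω‖ₑ := by
            rw [ENNReal.ofReal_mul (by positivity), ← Real.norm_eq_abs, ofReal_norm]
        _ ≤ _ := mul_le_mul_right (enorm_integral_le_lintegral_enorm _) _
    · rw [hN, hc₃, ENNReal.ofReal_mul (p := (t * B) ^ 2 * Real.exp (t * B)) (by positivity),
        ENNReal.ofReal_mul (p := t) ht.le]
  have hRi : Integrable (bridgeMean α t P R) := by
    refine ⟨?_, hRl.trans_lt ENNReal.ofReal_lt_top⟩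
    rw [funext hRq]
    exact ((hTm.add (measurable_bridgeMean_occupation hP hV hB)).sub
      (hA2m.div_const 2)).aestronglyMeasurable
  have hRint := abs_integral_le_of_lintegral_enorm_le hc₃0 hRl
  have hdec : bridgeMean α t P (fun ω => Real.exp (-A ω) - 1) = fun q =>
      bridgeMean α t P R q - bridgeMean α t P A q +
        (1 / 2 * bridgeMean α t P (fun ω => A ω ^ 2 - t * S ω) q +
          t / 2 * bridgeMean α t P S q) := by
    funext q
    rw [hRq, hQ]
    ring
  have hi1 : Integrable fun q => bridgeMean α t P R q - bridgeMean α t P A q := hRi.sub hA1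
  have hi2 : Integrable fun q => 1 / 2 * bridgeMean α t P (fun ω => A ω ^ 2 - t * S ω) q +
      t / 2 * bridgeMean α t P S q := (hQi.const_mul (1 / 2)).add (hS1.const_mul (t / 2))
  refine ⟨by rw [hdec]; exact hi1.add hi2, ?_⟩
  have hval : ∫ q, bridgeMean α t P (fun ω => Real.exp (-A ω) - 1) q =
      (∫ q, bridgeMean α t P R q) - t * (∫ x, V x) +
        (1 / 2 * (∫ q, bridgeMean α t P (fun ω => A ω ^ 2 - t * S ω) q) +
          t / 2 * (t * ∫ x, V x ^ 2)) := by
    rw [hdec, ← hAint, ← hSint, ← integral_sub hRi hA1, ← integral_const_mul,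
      ← integral_const_mul, ← integral_add (hQi.const_mul (1 / 2)) (hS1.const_mul (t / 2)),
      ← integral_add hi1 hi2]
  have hpow : t ^ (γ / α + 2) = t ^ (γ / α) * (t * t) := by
    rw [Real.rpow_add ht, Real.rpow_two, sq]
  have hfin : N * (B ^ 2 * Real.exp (t * B) * t ^ 3 +
      stableMomentConst d α γ * (M * t ^ (γ / α + 2))) = c₃ + 1 / 2 * c₂ := by
    rw [hpow, hc₂, hc₃]
    ring
  rw [hval, hfin]
  have h1 := abs_le.1 hRint
  have h2 := abs_le.1 hQint
  rw [abs_le]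
  constructor <;> nlinarith [h1.1, h1.2, h2.1, h2.2]

end Main

theorem theorem2 (d : ℕ) (hd : 1 ≤ d) (α γ : ℝ) (hα0 : 0 < α) (hα2 : α ≤ 2)
    (hγ0 : 0 < γ) (hγ : γ < min 1 α) :
    ∃ C : ℝ, 0 < C ∧
      ∀ (Ω : Type*) [MeasurableSpace Ω] (X : ℝ → Ω → EuclideanSpace ℝ (Fin d))
        (P : ℝ → EuclideanSpace ℝ (Fin d) → EuclideanSpace ℝ (Fin d) → Measure Ω),
        (∀ t : ℝ, 0 < t → ∀ x y, IsStableBridge α t x y X (P t x y)) →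
      ∀ (V : EuclideanSpace ℝ (Fin d) → ℝ) (M : ℝ),
        MemLp V 1 volume → MemLp V ∞ volume → 0 < M →
        (∀ x y, |V x - V y| ≤ M * ‖x - y‖ ^ γ) →
        (∀ t : ℝ, 0 < t →
          Integrable (fun q : EuclideanSpace ℝ (Fin d) × EuclideanSpace ℝ (Fin d) =>
            schrodingerKernel α X P V t q.1 q.2 - stableDensity α t (q.1 - q.2)) volume ∧
          |heatContent α X P V t + t * (∫ x, V x) - t ^ 2 / 2 * (∫ x, V x ^ 2)| ≤
            C * (eLpNorm V 1 volume).toReal *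
              ((eLpNorm V ∞ volume).toReal ^ 2 * Real.exp (t * (eLpNorm V ∞ volume).toReal) * t ^ 3
                + M * t ^ (γ / α + 2))) ∧
        (fun t : ℝ => heatContent α X P V t - (-t * (∫ x, V x) + t ^ 2 / 2 * (∫ x, V x ^ 2)))
          =O[𝓝[>] 0] (fun t : ℝ => t ^ (γ / α + 2)) := by
  have hγα : γ < α := hγ.trans_le (min_le_right _ _)
  have hK := stableMomentConst_nonneg (d := d) hγ0 hγα
  refine ⟨1 + stableMomentConst d α γ, by positivity, ?_⟩
  intro Ω _ X P hP V M hV1 hVinf hM hVM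
  have hVi : Integrable V := memLp_one_iff_integrable.1 hV1
  have hVc : Continuous V := by
    refine HolderWith.continuous (C := M.toNNReal) (r := γ.toNNReal) (fun x y => ?_)
      (Real.toNNReal_pos.2 hγ0)
    rw [edist_dist, edist_dist, Real.dist_eq, dist_eq_norm, Real.coe_toNNReal _ hγ0.le,
      ENNReal.ofReal_rpow_of_nonneg (norm_nonneg _) hγ0.le]
    change _ ≤ ENNReal.ofReal M * _
    rw [← ENNReal.ofReal_mul hM.le]
    exact ENNReal.ofReal_le_ofReal (hVM x y)
  set N : ℝ := (eLpNorm V 1 volume).toReal with hNdef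
  set B : ℝ := (eLpNorm V ∞ volume).toReal with hBdef
  have hN : ∫ x, ‖V x‖ = N := by
    rw [hNdef, eLpNorm_one_eq_lintegral_enorm, integral_norm_eq_lintegral_enorm hVi.1]
  have hN0 : 0 ≤ N := ENNReal.toReal_nonneg
  have hB0 : 0 ≤ B := ENNReal.toReal_nonneg
  -- by continuity the essential bound holds everywhere
  have hB : ∀ x, |V x| ≤ B := by
    have hae : ∀ᵐ x, |V x| ≤ B := by
      filter_upwards [ae_le_eLpNormEssSup (f := V) (μ := volume)] with x hx
      rw [← eLpNorm_exponent_top] at hx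
      have := (ENNReal.toReal_le_toReal enorm_ne_top hVinf.2.ne).2 hx
      rwa [toReal_enorm] at this
    have hcl : IsClosed {x | |V x| ≤ B} := isClosed_le hVc.abs continuous_const
    intro x
    have := Measure.dense_of_ae hae x
    rwa [hcl.closure_eq] at this
  have hpos : ∀ u : ℝ, 0 < u → ∀ z : EuclideanSpace ℝ (Fin d), 0 < stableDensity α u z := by
    intro u hu
    refine stableDensity_pos_of_ne_zero hd hα0 hu fun z => ?_
    have := (hP u hu z 0).stableDensity_ne_zero
    rwa [sub_zero] at this
  have hmain : ∀ t : ℝ, 0 < t →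
      Integrable (fun q : EuclideanSpace ℝ (Fin d) × EuclideanSpace ℝ (Fin d) =>
        schrodingerKernel α X P V t q.1 q.2 - stableDensity α t (q.1 - q.2)) volume ∧
      |heatContent α X P V t + t * (∫ x, V x) - t ^ 2 / 2 * (∫ x, V x ^ 2)| ≤
        (1 + stableMomentConst d α γ) * N * (B ^ 2 * Real.exp (t * B) * t ^ 3
            + M * t ^ (γ / α + 2)) := by
    intro t ht
    obtain ⟨hi, hle⟩ := heat_content_expansion hd hα0 ht hγ0 hγα hpos (hP t ht) hVc.measurable
      hVi hB hM hVM
    have hker : (fun q : EuclideanSpace ℝ (Fin d) × EuclideanSpace ℝ (Fin d) =>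
        schrodingerKernel α X P V t q.1 q.2 - stableDensity α t (q.1 - q.2)) =
        bridgeMean α t (P t) fun ω => Real.exp (-∫ s in Set.Ioo 0 t, V (X s ω)) - 1 := by
      funext q
      have hq := hP t ht q.1 q.2
      have := hq.isProbabilityMeasure
      have hE : Integrable (fun ω => Real.exp (-∫ s in Set.Ioo 0 t, V (X s ω)))
          (P t q.1 q.2) := by
        refine Integrable.of_bound (C := Real.exp (t * B))
          (hq.measurable_setIntegral_path hVc.measurable).neg.exp.aestronglyMeasurable
          (Eventually.of_forall fun ω => ?_)
        rw [Real.norm_eq_abs, Real.abs_exp]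
        exact Real.exp_le_exp.2 ((neg_le_abs _).trans
          (abs_setIntegral_comp_le ht hB fun s => X s ω))
      rw [bridgeMean, integral_sub hE (integrable_const _), schrodingerKernel]
      simp_rw [intervalIntegral.integral_of_le ht.le, integral_Ioc_eq_integral_Ioo]
      simp [mul_sub]
    have hcontent : heatContent α X P V t = ∫ q, bridgeMean α t (P t)
        (fun ω => Real.exp (-∫ s in Set.Ioo 0 t, V (X s ω)) - 1) q := by
      rw [← hker] at hi ⊢
      rw [heatContent, Measure.volume_eq_prod, integral_prod_symm _ hi]
    rw [hker, hcontent]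
    refine ⟨hi, hle.trans ?_⟩
    rw [hN, mul_comm _ N, mul_assoc N]
    refine mul_le_mul_of_nonneg_left ?_ hN0
    have h1 : 0 ≤ B ^ 2 * Real.exp (t * B) * t ^ 3 := by positivity
    have h2 : 0 ≤ M * t ^ (γ / α + 2) := by positivity
    nlinarith [mul_nonneg hK h1]
  refine ⟨hmain, ?_⟩
  refine IsBigO.of_bound ((1 + stableMomentConst d α γ) * N * (B ^ 2 * Real.exp B + M)) ?_
  filter_upwards [Ioo_mem_nhdsGT (zero_lt_one' ℝ)] with t ht
  have hpow : t ^ 3 ≤ t ^ (γ / α + 2) := by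
    rw [← Real.rpow_natCast]
    refine Real.rpow_le_rpow_of_exponent_ge ht.1 ht.2.le ?_
    have := (div_lt_one hα0).2 hγα
    push_cast
    linarith
  have ht0 : 0 < t := ht.1
  have htp : 0 ≤ t ^ (γ / α + 2) := Real.rpow_nonneg ht.1.le _
  have hexp : Real.exp (t * B) ≤ Real.exp B :=
    Real.exp_le_exp.2 (mul_le_of_le_one_left hB0 ht.2.le)
  rw [Real.norm_eq_abs, Real.norm_of_nonneg htp, mul_assoc _ (B ^ 2 * _ + M)]
  calc _ = |heatContent α X P V t + t * (∫ x, V x) - t ^ 2 / 2 * (∫ x, V x ^ 2)| := by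
        congr 1
        ring
    _ ≤ _ := (hmain t ht.1).2
    _ ≤ _ := by
        refine mul_le_mul_of_nonneg_left ?_ (by positivity)
        rw [add_mul]
        gcongr
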